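/- Let $(\overline M,\overline g)$ be a semi-Riemannian manifold of constant sectional curvature $c$, with Levi-Civita connection $\overline\nabla$, and let $(M,g)$ be a lightlike hypersurface of $\overline M$: an immersed submanifold of codimension one, with induced metric $g$, whose radical $\mathrm{Rad}\,TM=TM\cap TM^{\perp}$ is a smooth distribution of rank one. A screen distribution is a smooth distribution $S(TM)$ with $TM=\mathrm{Rad}\,TM\perp S(TM)$ on which $g$ is nondegenerate. It determines the line bundle $\mathrm{tr}(TM)$ spanned locally by the null sections $N$ orthogonal to $S(TM)$ with $\overline g(\xi,N)=1$ for a local section $\xi$ of $\mathrm{Rad}\,TM$, and then, for $X,Y\in\Gamma(TM)$, the induced connection $\nabla$ and the second fundamental form $h$ through $\overline\nabla_XY=\nabla_XY+h(X,Y)$, with $\nabla_XY\in\Gamma(TM)$ and $h(X,Y)\in\Gamma(\mathrm{tr}(TM))$. Let $R(X,Y)Z=\nabla_X\nabla_YZ-\nabla_Y\nabla_XZ-\nabla_{[X,Y]}Z$ and $R(X,Y,Z,T)=g(R(X,Y)Z,T)$ be the induced curvature. The screen distribution is called admissible if $R$ is an algebraic curvature tensor, that is, for all $X,Y,Z,W\in\Gamma(TM)$,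 $$R(X,Y,Z,W)=-R(Y,X,Z,W)=R(Z,W,X,Y),\qquad R(X,Y,Z,W)+R(Y,Z,X,W)+R(Z,X,Y,W)=0.$$ Suppose that $M$ is totally umbilical: for some screen distribution there is a smooth section $H$ of $\mathrm{tr}(TM)$ with $h(X,Y)=g(X,Y)H$ for all $X,Y\in\Gamma(TM)$ (a property that does not depend on the screen distribution; $H$ may be nowhere zero, the proper case, or may have zeros). Then for every admissible screen distribution $S(TM)$ the lightlike hypersurface $(M,g,S(TM))$ is semi-symmetric: for all $V_1,V_2,X,Y,Z,T\in\Gamma(TM)$, $$(R(V_1,V_2)\cdot R)(X,Y,Z,T)=-R(R(V_1,V_2)X,Y,Z,T)-R(X,R(V_1,V_2)Y,Z,T)-R(X,Y,R(V_1,V_2)Z,T)-R(X,Y,Z,R(V_1,V_2)T)=0.$$ -/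

import Mathlib

open scoped Manifold ContDiff Topology
open Bundle

namespace LightlikeGeometry

noncomputable section

/-! ## Manifolds, vector fields, connections

`M` is a manifold (without boundary) modelled on the finite-dimensional space `E`, and `N` one
modelled on `F`.  `M` plays the role of the hypersurface and `N` that of the ambient manifold. -/

variable {E : Type*} [NormedAddCommGroup E] [NormedSpace ℝ E]
  {F : Type*} [NormedAddCommGroup F] [NormedSpace ℝ F]
  {M : Type*} [TopologicalSpace M] [ChartedSpace E M]
  {N : Type*} [TopologicalSpace N] [ChartedSpace F N]

/-- The vector field `X` on `M` is smooth, i.e. `X ∈ Γ(TM)`. -/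
def IsSmoothField [IsManifold 𝓘(ℝ, E) ∞ M] (X : Π x : M, TangentSpace 𝓘(ℝ, E) x) : Prop :=
  ContMDiff 𝓘(ℝ, E) 𝓘(ℝ, E).tangent ∞ (fun x ↦ (⟨x, X x⟩ : TangentBundle 𝓘(ℝ, E) M))

/-- `D` is a smooth distribution of rank `r` on `M`: near every point it is spanned by `r`
smooth pointwise linearly independent vector fields. -/
def IsSmoothDistribution [IsManifold 𝓘(ℝ, E) ∞ M]
    (D : Π x : M, Submodule ℝ (TangentSpace 𝓘(ℝ, E) x)) (r : ℕ) : Prop :=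
  ∀ x : M, ∃ U ∈ 𝓝 x, ∃ X : Fin r → Π y : M, TangentSpace 𝓘(ℝ, E) y,
    (∀ i, ContMDiffOn 𝓘(ℝ, E) 𝓘(ℝ, E).tangent ∞
      (fun y ↦ (⟨y, X i y⟩ : TangentBundle 𝓘(ℝ, E) M)) U) ∧
    ∀ y ∈ U, LinearIndependent ℝ (fun i ↦ X i y) ∧
      Submodule.span ℝ (Set.range fun i ↦ X i y) = D y

/-- The curvature operator `R(X,Y)Z = ∇_X ∇_Y Z - ∇_Y ∇_X Z - ∇_[X,Y] Z` of the operator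
`(X, Y) ↦ D X Y = ∇_X Y` on vector fields. -/
def curvature
    (D : (Π x : M, TangentSpace 𝓘(ℝ, E) x) → (Π x : M, TangentSpace 𝓘(ℝ, E) x) →
      (Π x : M, TangentSpace 𝓘(ℝ, E) x))
    (X Y Z : Π x : M, TangentSpace 𝓘(ℝ, E) x) : Π x : M, TangentSpace 𝓘(ℝ, E) x :=
  fun x ↦ D X (D Y Z) x - D Y (D X Z) x - D (VectorField.mlieBracket 𝓘(ℝ, E) X Y) Z x

/-! ## Semi-Riemannian ambient manifolds -/

variable (F N) in
/-- A semi-Riemannian metric on `N`: a smooth field of nondegenerate symmetric bilinear forms of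
constant index (the index being the maximal dimension of a negative definite subspace). -/
structure SemiRiemannianMetric [IsManifold 𝓘(ℝ, F) ∞ N] where
  /-- the scalar product on the tangent spaces -/
  val (q : N) : TangentSpace 𝓘(ℝ, F) q →L[ℝ] TangentSpace 𝓘(ℝ, F) q →L[ℝ] ℝ
  symm (q : N) (v w : TangentSpace 𝓘(ℝ, F) q) : val q v w = val q w v
  nondegenerate (q : N) (v : TangentSpace 𝓘(ℝ, F) q) (hv : ∀ w, val q v w = 0) : v = 0
  contMDiff : ContMDiff 𝓘(ℝ, F) (𝓘(ℝ, F).prod 𝓘(ℝ, F →L[ℝ] F →L[ℝ] ℝ)) ∞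
    (fun q ↦ TotalSpace.mk' (F →L[ℝ] F →L[ℝ] ℝ)
      (E := fun q : N ↦ TangentSpace 𝓘(ℝ, F) q →L[ℝ] TangentSpace 𝓘(ℝ, F) q →L[ℝ] ℝ) q (val q))
  /-- the index of the metric -/
  index : ℕ
  isGreatest_index (q : N) :
    IsGreatest {k : ℕ | ∃ W : Submodule ℝ (TangentSpace 𝓘(ℝ, F) q),
      Module.finrank ℝ W = k ∧ ∀ w ∈ W, w ≠ 0 → val q w w < 0} index

/-- `nabla` is the Levi-Civita connection of the semi-Riemannian metric `g`: it is smooth,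
torsion-free and metric.  In the notation of `CovariantDerivative`, `nabla Y q v = ∇_v Y`. -/
structure IsLeviCivita [FiniteDimensional ℝ F] [IsManifold 𝓘(ℝ, F) ∞ N]
    (g : SemiRiemannianMetric F N)
    (nabla : CovariantDerivative 𝓘(ℝ, F) F (TangentSpace 𝓘(ℝ, F) : N → Type _)) : Prop where
  smooth : nabla.ContMDiffCovariantDerivative ∞
  torsion_free : nabla.torsion = 0
  metric : ∀ (Y Z : Π q : N, TangentSpace 𝓘(ℝ, F) q) (q : N),
    MDifferentiableAt 𝓘(ℝ, F) 𝓘(ℝ, F).tangent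
      (fun p ↦ (⟨p, Y p⟩ : TangentBundle 𝓘(ℝ, F) N)) q →
    MDifferentiableAt 𝓘(ℝ, F) 𝓘(ℝ, F).tangent
      (fun p ↦ (⟨p, Z p⟩ : TangentBundle 𝓘(ℝ, F) N)) q →
    ∀ v : TangentSpace 𝓘(ℝ, F) q,
      mvfderiv 𝓘(ℝ, F) (fun p ↦ g.val p (Y p) (Z p)) q v =
        g.val q (nabla Y q v) (Z q) + g.val q (Y q) (nabla Z q v)

/-- `N` has constant sectional curvature `c`: every nondegenerate tangent plane, spanned by `X q`
and `Y q`, has sectional curvature `g(R(X,Y)Y,X) / (g(X,X)g(Y,Y) - g(X,Y)²) = c`. -/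
def HasConstantSectionalCurvature [IsManifold 𝓘(ℝ, F) ∞ N] (g : SemiRiemannianMetric F N)
    (nabla : CovariantDerivative 𝓘(ℝ, F) F (TangentSpace 𝓘(ℝ, F) : N → Type _)) (c : ℝ) : Prop :=
  ∀ X Y : Π q : N, TangentSpace 𝓘(ℝ, F) q, IsSmoothField X → IsSmoothField Y → ∀ q : N,
    g.val q (X q) (X q) * g.val q (Y q) (Y q) - g.val q (X q) (Y q) ^ 2 ≠ 0 →
    g.val q (curvature (fun V W p ↦ nabla W p (V p)) X Y Y q) (X q) /
      (g.val q (X q) (X q) * g.val q (Y q) (Y q) - g.val q (X q) (Y q) ^ 2) = c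

/-- The covariant derivative `∇_v V` of a vector field `V` along a map `ι : M → N`
(`V y ∈ T_{ι y} N`) in the direction `v ∈ T_x M`, i.e. the pullback connection on `ι^* TN`.
With `e` the trivialization of `TN` around `ι x` given by a chart, `V^` the representation of `V`
in `e` and `E_w` the local field on `N` whose representation in `e` is the constant vector `w`, it
is `e⁻¹ (d V^ (v)) + (∇_{dι v} E_w) (ι x)` with `w = V^ x`. -/
def covAlong [IsManifold 𝓘(ℝ, F) ∞ N]
    (nabla : CovariantDerivative 𝓘(ℝ, F) F (TangentSpace 𝓘(ℝ, F) : N → Type _)) (ι : M → N)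
    (V : Π y : M, TangentSpace 𝓘(ℝ, F) (ι y)) (x : M) (v : TangentSpace 𝓘(ℝ, E) x) :
    TangentSpace 𝓘(ℝ, F) (ι x) :=
  let e := trivializationAt F (TangentSpace 𝓘(ℝ, F) : N → Type _) (ι x)
  let coord : M → F := fun y ↦ (e (⟨ι y, V y⟩ : TangentBundle 𝓘(ℝ, F) N)).2
  e.symm (ι x) (mvfderiv 𝓘(ℝ, E) coord x v) +
    nabla (fun q ↦ e.symm q (coord x)) (ι x) (mfderiv 𝓘(ℝ, E) 𝓘(ℝ, F) ι x v)

/-! ## Lightlike hypersurfaces -/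

/-- The (degenerate) metric `g = ι^* gbar` induced on `M`. -/
def inducedMetric [IsManifold 𝓘(ℝ, F) ∞ N] (g : SemiRiemannianMetric F N) (ι : M → N) (x : M)
    (u v : TangentSpace 𝓘(ℝ, E) x) : ℝ :=
  g.val (ι x) (mfderiv 𝓘(ℝ, E) 𝓘(ℝ, F) ι x u) (mfderiv 𝓘(ℝ, E) 𝓘(ℝ, F) ι x v)

/-- The radical distribution `Rad T_x M = T_x M ∩ T_x M^⊥`. -/
def radical [IsManifold 𝓘(ℝ, F) ∞ N] (g : SemiRiemannianMetric F N) (ι : M → N) (x : M) :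
    Submodule ℝ (TangentSpace 𝓘(ℝ, E) x) where
  carrier := {u | ∀ v, inducedMetric g ι x u v = 0}
  add_mem' := by
    intro a b ha hb v
    have ha' := ha v
    have hb' := hb v
    simp only [inducedMetric] at ha' hb' ⊢
    simp [ha', hb']
  zero_mem' := by
    intro v
    simp [inducedMetric]
  smul_mem' := by
    intro a b hb v
    have hb' := hb v
    simp only [inducedMetric] at hb' ⊢
    simp [hb']

/-- `ι : M → N` is a lightlike hypersurface: an immersed submanifold of codimension one whose
radical distribution is a smooth distribution of rank one. -/
structure IsLightlikeHypersurface [IsManifold 𝓘(ℝ, E) ∞ M] [IsManifold 𝓘(ℝ, F) ∞ N]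
    (g : SemiRiemannianMetric F N) (ι : M → N) : Prop where
  immersion : Manifold.IsImmersion 𝓘(ℝ, E) 𝓘(ℝ, F) ∞ ι
  codim : Module.finrank ℝ F = Module.finrank ℝ E + 1
  radical_smooth : IsSmoothDistribution (radical (E := E) g ι) 1

/-- A screen distribution `S(TM)`: a smooth distribution complementary to the radical in `TM`, on
which the induced metric is nondegenerate. -/
structure ScreenDistribution [IsManifold 𝓘(ℝ, E) ∞ M] [IsManifold 𝓘(ℝ, F) ∞ N]
    (g : SemiRiemannianMetric F N) (ι : M → N) where
  /-- the underlying field of subspaces -/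
  space (x : M) : Submodule ℝ (TangentSpace 𝓘(ℝ, E) x)
  smooth : ∃ k : ℕ, IsSmoothDistribution space k
  isCompl (x : M) : IsCompl (space x) (radical g ι x)
  nondegenerate (x : M) : ∀ u ∈ space x, (∀ v ∈ space x, inducedMetric g ι x u v = 0) → u = 0

section Induced

variable [IsManifold 𝓘(ℝ, E) ∞ M] [IsManifold 𝓘(ℝ, F) ∞ N]
  {g : SemiRiemannianMetric F N} {ι : M → N}

/-- The fibre at `x` of the lightlike transversal bundle `tr(TM)` of the screen `S`: the line
spanned by the null vectors `n ∈ T_{ι x} N` orthogonal to the screen with `gbar(ξ, n) = 1` for some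
`ξ` in the radical. -/
def transversal (S : ScreenDistribution (E := E) g ι) (x : M) :
    Submodule ℝ (TangentSpace 𝓘(ℝ, F) (ι x)) :=
  Submodule.span ℝ {n | (∀ s ∈ S.space x, g.val (ι x) (mfderiv 𝓘(ℝ, E) 𝓘(ℝ, F) ι x s) n = 0) ∧
    g.val (ι x) n n = 0 ∧
    ∃ ξ ∈ radical g ι x, g.val (ι x) (mfderiv 𝓘(ℝ, E) 𝓘(ℝ, F) ι x ξ) n = 1}

/-- The tangential component of `V ∈ T_{ι x} N` in the decomposition
`T_{ι x} N = dι(T_x M) ⊕ tr(TM)_x`, as a vector of `T_x M`: the unique `u` with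
`V - dι u ∈ tr(TM)_x`. -/
def tangentialPart (S : ScreenDistribution (E := E) g ι) (x : M)
    (V : TangentSpace 𝓘(ℝ, F) (ι x)) : TangentSpace 𝓘(ℝ, E) x :=
  Classical.epsilon fun u ↦ V - mfderiv 𝓘(ℝ, E) 𝓘(ℝ, F) ι x u ∈ transversal S x

/-- The ambient derivative `∇bar_X Y ∈ T N|_M` of vector fields `X, Y` on `M`. -/
def ambientDeriv
    (nabla : CovariantDerivative 𝓘(ℝ, F) F (TangentSpace 𝓘(ℝ, F) : N → Type _)) (ι : M → N)
    (X Y : Π x : M, TangentSpace 𝓘(ℝ, E) x) (x : M) : TangentSpace 𝓘(ℝ, F) (ι x) :=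
  covAlong nabla ι (fun y ↦ mfderiv 𝓘(ℝ, E) 𝓘(ℝ, F) ι y (Y y)) x (X x)

/-- The induced connection `∇_X Y` on `M`, from the Gauss formula `∇bar_X Y = ∇_X Y + h(X,Y)`. -/
def inducedConnection
    (nabla : CovariantDerivative 𝓘(ℝ, F) F (TangentSpace 𝓘(ℝ, F) : N → Type _))
    (S : ScreenDistribution (E := E) g ι)
    (X Y : Π x : M, TangentSpace 𝓘(ℝ, E) x) : Π x : M, TangentSpace 𝓘(ℝ, E) x :=
  fun x ↦ tangentialPart S x (ambientDeriv nabla ι X Y x)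

/-- The second fundamental form `h(X,Y) = ∇bar_X Y - ∇_X Y` of `(M, g, S(TM))`. -/
def secondFundamentalForm
    (nabla : CovariantDerivative 𝓘(ℝ, F) F (TangentSpace 𝓘(ℝ, F) : N → Type _))
    (S : ScreenDistribution (E := E) g ι)
    (X Y : Π x : M, TangentSpace 𝓘(ℝ, E) x) (x : M) : TangentSpace 𝓘(ℝ, F) (ι x) :=
  ambientDeriv nabla ι X Y x -
    mfderiv 𝓘(ℝ, E) 𝓘(ℝ, F) ι x (inducedConnection nabla S X Y x)

/-- The induced Riemann curvature `R(X,Y)Z` of `(M, g, S(TM))`. -/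
def inducedCurvature
    (nabla : CovariantDerivative 𝓘(ℝ, F) F (TangentSpace 𝓘(ℝ, F) : N → Type _))
    (S : ScreenDistribution (E := E) g ι)
    (X Y Z : Π x : M, TangentSpace 𝓘(ℝ, E) x) : Π x : M, TangentSpace 𝓘(ℝ, E) x :=
  curvature (inducedConnection nabla S) X Y Z

/-- The `(0,4)` induced curvature tensor `R(X,Y,Z,T) = g(R(X,Y)Z, T)`. -/
def inducedCurvatureForm
    (nabla : CovariantDerivative 𝓘(ℝ, F) F (TangentSpace 𝓘(ℝ, F) : N → Type _))
    (S : ScreenDistribution (E := E) g ι)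
    (X Y Z T : Π x : M, TangentSpace 𝓘(ℝ, E) x) (x : M) : ℝ :=
  inducedMetric g ι x (inducedCurvature nabla S X Y Z x) (T x)

/-- The screen distribution `S(TM)` is admissible: the induced Riemann curvature is an algebraic
curvature tensor. -/
def IsAdmissible
    (nabla : CovariantDerivative 𝓘(ℝ, F) F (TangentSpace 𝓘(ℝ, F) : N → Type _))
    (S : ScreenDistribution (E := E) g ι) : Prop :=
  ∀ X Y Z W : Π x : M, TangentSpace 𝓘(ℝ, E) x,
    IsSmoothField X → IsSmoothField Y → IsSmoothField Z → IsSmoothField W → ∀ x : M,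
      inducedCurvatureForm nabla S X Y Z W x = - inducedCurvatureForm nabla S Y X Z W x ∧
      inducedCurvatureForm nabla S X Y Z W x = inducedCurvatureForm nabla S Z W X Y x ∧
      inducedCurvatureForm nabla S X Y Z W x + inducedCurvatureForm nabla S Y Z X W x +
        inducedCurvatureForm nabla S Z X Y W x = 0

/-- `(R(V₁,V₂) · R)(X,Y,Z,T)`: the curvature operator `R(V₁,V₂)` acting as a derivation on the
`(0,4)` induced curvature tensor. -/
def curvatureDerivation
    (nabla : CovariantDerivative 𝓘(ℝ, F) F (TangentSpace 𝓘(ℝ, F) : N → Type _))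
    (S : ScreenDistribution (E := E) g ι)
    (V₁ V₂ X Y Z T : Π x : M, TangentSpace 𝓘(ℝ, E) x) (x : M) : ℝ :=
  - inducedCurvatureForm nabla S (inducedCurvature nabla S V₁ V₂ X) Y Z T x
  - inducedCurvatureForm nabla S X (inducedCurvature nabla S V₁ V₂ Y) Z T x
  - inducedCurvatureForm nabla S X Y (inducedCurvature nabla S V₁ V₂ Z) T x
  - inducedCurvatureForm nabla S X Y Z (inducedCurvature nabla S V₁ V₂ T) x

/-- The lightlike hypersurface `(M, g, S(TM))` is semi-symmetric: `R · R = 0`. -/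
def IsSemiSymmetric
    (nabla : CovariantDerivative 𝓘(ℝ, F) F (TangentSpace 𝓘(ℝ, F) : N → Type _))
    (S : ScreenDistribution (E := E) g ι) : Prop :=
  ∀ V₁ V₂ X Y Z T : Π x : M, TangentSpace 𝓘(ℝ, E) x,
    IsSmoothField V₁ → IsSmoothField V₂ → IsSmoothField X → IsSmoothField Y →
    IsSmoothField Z → IsSmoothField T → ∀ x : M,
      curvatureDerivation nabla S V₁ V₂ X Y Z T x = 0

end Induced

/-- `ι : M → N` is totally umbilical: for some screen distribution there is a smooth section `H`
of `tr(TM)` with `h(X,Y) = g(X,Y) H` for all `X, Y ∈ Γ(TM)`.  (For a hypersurface this property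
does not depend on the screen distribution.) -/
def IsTotallyUmbilical [IsManifold 𝓘(ℝ, E) ∞ M] [IsManifold 𝓘(ℝ, F) ∞ N]
    (g : SemiRiemannianMetric F N)
    (nabla : CovariantDerivative 𝓘(ℝ, F) F (TangentSpace 𝓘(ℝ, F) : N → Type _)) (ι : M → N) :
    Prop :=
  ∃ (S : ScreenDistribution (E := E) g ι) (H : Π x : M, TangentSpace 𝓘(ℝ, F) (ι x)),
    ContMDiff 𝓘(ℝ, E) 𝓘(ℝ, F).tangent ∞
      (fun x ↦ (⟨ι x, H x⟩ : TangentBundle 𝓘(ℝ, F) N)) ∧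
    (∀ x, H x ∈ transversal S x) ∧
    ∀ X Y : Π x : M, TangentSpace 𝓘(ℝ, E) x, IsSmoothField X → IsSmoothField Y → ∀ x : M,
      secondFundamentalForm nabla S X Y x = inducedMetric g ι x (X x) (Y x) • H x

end

end LightlikeGeometry

open scoped Manifold ContDiff Topology
open Bundle

namespace LightlikeGeometry

noncomputable section

variable {E : Type*} [NormedAddCommGroup E] [NormedSpace ℝ E]
  {F : Type*} [NormedAddCommGroup F] [NormedSpace ℝ F]
  {M : Type*} [TopologicalSpace M] [ChartedSpace E M]
  {N : Type*} [TopologicalSpace N] [ChartedSpace F N]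

/-! ### Calculus on manifolds -/

section

variable {G : Type*} [NormedAddCommGroup G] [NormedSpace ℝ G]
  {G₁ : Type*} [NormedAddCommGroup G₁] [NormedSpace ℝ G₁]
  {G₂ : Type*} [NormedAddCommGroup G₂] [NormedSpace ℝ G₂]

/-! Write `B` for the degenerate metric of `M` at a point `x`. For an arbitrary screen, the Gauss
formula reads `∇bar_Y Z = ∇_Y Z + B(Y,Z) H`, with `H` a local transversal section. Differentiating
it once more, and using that the ambient curvature is `c (g(Y,Z) X - g(X,Z) Y)`, the tangential
component gives `R(X,Y)Z = B(Y,Z) L X - B(X,Z) L Y`, where `L u = c u - (∇bar_u H)^tan`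
(`exists_inducedCurvature_eq`).

The rest is algebra at `x`. Pair symmetry of `R` forces `B(L X, W) = μ B(X, W)` for a number `μ`
(`exists_scalar_of_pair_symm`). So the `(0,4)` tensor is `μ` times the model tensor built from `B`
alone, and `R(V₁,V₂)` is itself skew for `B`; a skew operator, acting as a derivation, kills
everything built from `B` (`derivation_eq_zero`). The scalar may vary with the point and may vanish,
so zeros of `H` cause no trouble.

The geometric input needs three things. First, the curvature of the pullback connection on `ι^*TN`
must be the ambient curvature: both are computed from one local connection form
(`IsConnectionForm.curvature_along`, applied to `ι` and to the identity). Second, constant sectional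
curvature on nondegenerate planes must determine the whole tensor
(`HasConstantSectionalCurvature.coordSymm_curvatureForm`); a nondegenerate plane is always
available, spanned by the null pair `ξ`, `n`. Third, smooth local null pairs must exist
(`exists_isNullPair`), which makes the induced connection smooth and lets umbilicity pass from one
screen to another: the transversal coefficient of a vector is its product with `ξ`, in which the
screen does not enter. -/

theorem mvfderiv_congr {f f' : M → G} {x : M} (h : f =ᶠ[𝓝 x] f') :
    mvfderiv 𝓘(ℝ, E) f x = mvfderiv 𝓘(ℝ, E) f' x := by
  have h0 := h.eq_of_nhds
  ext v
  -- The two differentials take values in tangent spaces at different base points; both are read as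
  -- maps `E →L[ℝ] G`. The same ascription recurs below.
  have := congrArg (fun (L : E →L[ℝ] G) ↦ L v)
    (h.mfderiv_eq (I := 𝓘(ℝ, E)) (I' := 𝓘(ℝ, G)) : (_ : E →L[ℝ] G) = _)
  exact this

theorem mvfderiv_clm_comp (L : G₁ →L[ℝ] G) {f : M → G₁} {x : M}
    (hf : MDifferentiableAt 𝓘(ℝ, E) 𝓘(ℝ, G₁) f x) (u : TangentSpace 𝓘(ℝ, E) x) :
    mvfderiv 𝓘(ℝ, E) (fun y ↦ L (f y)) x u = L (mvfderiv 𝓘(ℝ, E) f x u) := by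
  have h := (HasMFDerivAt.comp x L.hasFDerivAt.hasMFDerivAt hf.hasMFDerivAt).mfderiv
  exact congrArg (fun (L : E →L[ℝ] G) ↦ L u) (h : (_ : E →L[ℝ] G) = _)

theorem mvfderiv_comp_map {f : N → G} {ι : M → N} {x : M}
    (hf : MDifferentiableAt 𝓘(ℝ, F) 𝓘(ℝ, G) f (ι x)) (hι : MDifferentiableAt 𝓘(ℝ, E) 𝓘(ℝ, F) ι x)
    (u : TangentSpace 𝓘(ℝ, E) x) :
    mvfderiv 𝓘(ℝ, E) (fun y ↦ f (ι y)) x u =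
      mvfderiv 𝓘(ℝ, F) f (ι x) (mfderiv 𝓘(ℝ, E) 𝓘(ℝ, F) ι x u) := by
  have h := (HasMFDerivAt.comp x hf.hasMFDerivAt hι.hasMFDerivAt).mfderiv
  exact congrArg (fun (L : E →L[ℝ] G) ↦ L u) (h : (_ : E →L[ℝ] G) = _)

theorem contMDiffAt_clm_comp (L : G₁ →L[ℝ] G) {f : M → G₁} {x : M}
    (hf : ContMDiffAt 𝓘(ℝ, E) 𝓘(ℝ, G₁) ∞ f x) :
    ContMDiffAt 𝓘(ℝ, E) 𝓘(ℝ, G) ∞ (fun y ↦ L (f y)) x :=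
  L.contDiff.contMDiff.contMDiffAt.comp x hf

theorem contMDiffAt_smulRight (β : G₁ →L[ℝ] ℝ) {f : M → G} {x : M}
    (hf : ContMDiffAt 𝓘(ℝ, E) 𝓘(ℝ, G) ∞ f x) :
    ContMDiffAt 𝓘(ℝ, E) 𝓘(ℝ, G₁ →L[ℝ] G) ∞ (fun y ↦ β.smulRight (f y)) x :=
  contMDiffAt_clm_comp (ContinuousLinearMap.smulRightL ℝ G₁ G β) hf

theorem mvfderiv_bilin (B : G₁ →L[ℝ] G₂ →L[ℝ] G) {f : M → G₁} {k : M → G₂} {x : M}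
    (hf : MDifferentiableAt 𝓘(ℝ, E) 𝓘(ℝ, G₁) f x) (hk : MDifferentiableAt 𝓘(ℝ, E) 𝓘(ℝ, G₂) k x)
    (u : TangentSpace 𝓘(ℝ, E) x) :
    mvfderiv 𝓘(ℝ, E) (fun y ↦ B (f y) (k y)) x u =
      B (mvfderiv 𝓘(ℝ, E) f x u) (k x) + B (f x) (mvfderiv 𝓘(ℝ, E) k x u) := by
  have h1 : HasMFDerivAt 𝓘(ℝ, E) 𝓘(ℝ, G₁ × G₂) (fun y ↦ (f y, k y)) x
      (ContinuousLinearMap.prod (mvfderiv 𝓘(ℝ, E) f x) (mvfderiv 𝓘(ℝ, E) k x)) :=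
    ⟨ContinuousAt.prodMk hf.continuousAt hk.continuousAt,
      hf.hasMFDerivAt.2.prodMk hk.hasMFDerivAt.2⟩
  have h2 := (B.isBoundedBilinearMap.hasFDerivAt (f x, k x)).hasMFDerivAt
  have h3 := (HasMFDerivAt.comp x h2 h1).mfderiv
  have h4 := congrArg (fun (L : E →L[ℝ] G) ↦ L u) (h3 : (_ : E →L[ℝ] G) = _)
  rw [add_comm]
  exact h4

theorem mvfderiv_clm_apply {c : M → G₁ →L[ℝ] G} {k : M → G₁} {x : M}
    (hc : MDifferentiableAt 𝓘(ℝ, E) 𝓘(ℝ, G₁ →L[ℝ] G) c x)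
    (hk : MDifferentiableAt 𝓘(ℝ, E) 𝓘(ℝ, G₁) k x) (u : TangentSpace 𝓘(ℝ, E) x) :
    mvfderiv 𝓘(ℝ, E) (fun y ↦ c y (k y)) x u =
      mvfderiv 𝓘(ℝ, E) c x u (k x) + c x (mvfderiv 𝓘(ℝ, E) k x u) :=
  mvfderiv_bilin (ContinuousLinearMap.id ℝ (G₁ →L[ℝ] G)) hc hk u

theorem contMDiffAt_mfderiv_apply [IsManifold 𝓘(ℝ, E) ∞ M] [IsManifold 𝓘(ℝ, F) ∞ N]
    {f : M → N} {x : M} (hf : ContMDiffAt 𝓘(ℝ, E) 𝓘(ℝ, F) ∞ f x)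
    {X : Π y : M, TangentSpace 𝓘(ℝ, E) y}
    (hX : ContMDiffAt 𝓘(ℝ, E) 𝓘(ℝ, E).tangent ∞
      (fun y ↦ (⟨y, X y⟩ : TangentBundle 𝓘(ℝ, E) M)) x) :
    ContMDiffAt 𝓘(ℝ, E) 𝓘(ℝ, F).tangent ∞
      (fun y ↦ (⟨f y, mfderiv 𝓘(ℝ, E) 𝓘(ℝ, F) f y (X y)⟩ : TangentBundle 𝓘(ℝ, F) N)) x :=
  ContMDiffAt.clm_apply_of_inCoordinates (b₁ := id) (b₂ := f)
    (hf.mfderiv_const (m := ∞) le_rfl) hX hf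

theorem contMDiffAt_mvfderiv_apply [IsManifold 𝓘(ℝ, E) ∞ M]
    {f : M → G} {x : M} (hf : ContMDiffAt 𝓘(ℝ, E) 𝓘(ℝ, G) ∞ f x)
    {X : Π y : M, TangentSpace 𝓘(ℝ, E) y}
    (hX : ContMDiffAt 𝓘(ℝ, E) 𝓘(ℝ, E).tangent ∞
      (fun y ↦ (⟨y, X y⟩ : TangentBundle 𝓘(ℝ, E) M)) x) :
    ContMDiffAt 𝓘(ℝ, E) 𝓘(ℝ, G) ∞ (fun y ↦ mvfderiv 𝓘(ℝ, E) f y (X y)) x := by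
  have h := (contMDiffAt_totalSpace.1 (contMDiffAt_mfderiv_apply hf hX)).2
  refine h.congr_of_eventuallyEq (Filter.Eventually.of_forall fun y ↦ ?_)
  simp only [trivializationAt_model_space_apply]
  rfl

/-- In the chart at `x`, each iterated derivative is a second derivative of `f'` plus `Df'` applied
to the derivative of a field. Symmetry of the second derivative cancels the first kind of term, and
the second kind assembles to the bracket of the representatives. -/
theorem mvfderiv_mlieBracket [CompleteSpace E] [IsManifold 𝓘(ℝ, E) ∞ M]
    {f : M → G} {x : M} (hf : ContMDiffAt 𝓘(ℝ, E) 𝓘(ℝ, G) ∞ f x)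
    {X Y : Π y : M, TangentSpace 𝓘(ℝ, E) y}
    (hX : ContMDiffAt 𝓘(ℝ, E) 𝓘(ℝ, E).tangent ∞
      (fun y ↦ (⟨y, X y⟩ : TangentBundle 𝓘(ℝ, E) M)) x)
    (hY : ContMDiffAt 𝓘(ℝ, E) 𝓘(ℝ, E).tangent ∞
      (fun y ↦ (⟨y, Y y⟩ : TangentBundle 𝓘(ℝ, E) M)) x) :
    mvfderiv 𝓘(ℝ, E) f x (VectorField.mlieBracket 𝓘(ℝ, E) X Y x) =
      mvfderiv 𝓘(ℝ, E) (fun y ↦ mvfderiv 𝓘(ℝ, E) f y (Y y)) x (X x) -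
        mvfderiv 𝓘(ℝ, E) (fun y ↦ mvfderiv 𝓘(ℝ, E) f y (X y)) x (Y x) := by
  set φ := extChartAt 𝓘(ℝ, E) x with hφ
  -- the representations of the function and of a field in the chart
  let f' : E → G := f ∘ φ.symm
  let rep (Z : Π y : M, TangentSpace 𝓘(ℝ, E) y) : E → E :=
    VectorField.mpullbackWithin 𝓘(ℝ, E) 𝓘(ℝ, E) φ.symm Z (Set.range 𝓘(ℝ, E))
  have hf' : ContDiffAt ℝ ∞ f' (φ x) := by
    have := (contMDiffAt_iff (I := 𝓘(ℝ, E)) (I' := 𝓘(ℝ, G)).1 hf).2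
    rw [← contDiffWithinAt_univ]
    simpa [f', hφ, Function.comp_def, extChartAt_model_space_eq_id] using! this
  have hf'd : ∀ᶠ p in 𝓝 (φ x), DifferentiableAt ℝ f' p := by
    have := (hf'.of_le (m := 1) (by exact_mod_cast le_top)).eventually (by simp)
    filter_upwards [this] with p hp using hp.differentiableAt one_ne_zero
  have hf'2 : DifferentiableAt ℝ (fderiv ℝ f') (φ x) :=
    (hf'.fderiv_right (m := ∞) le_rfl).differentiableAt (by simp)
  have hchain {k : E → G} {y : M} (hy : y ∈ φ.source) (hk : DifferentiableAt ℝ k (φ y))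
      (v : TangentSpace 𝓘(ℝ, E) y) :
      mvfderiv 𝓘(ℝ, E) (k ∘ φ) y v = fderiv ℝ k (φ y) (mfderiv 𝓘(ℝ, E) 𝓘(ℝ, E) φ y v) := by
    have a := mfderiv_comp y hk.mdifferentiableAt
      (mdifferentiableAt_extChartAt (I := 𝓘(ℝ, E)) (by simpa [hφ] using hy))
    rw [mfderiv_eq_fderiv] at a
    exact congrArg (fun (L : E →L[ℝ] G) ↦ L v) (a : (_ : E →L[ℝ] G) = _)
  have hrep (Z : Π y : M, TangentSpace 𝓘(ℝ, E) y) {y : M} (hy : y ∈ φ.source) :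
      rep Z (φ y) = mfderiv 𝓘(ℝ, E) 𝓘(ℝ, E) φ y (Z y) := by
    have a : (rep Z (φ y) : E) = (mfderiv[Set.range 𝓘(ℝ, E)] φ.symm (φ y)).inverse
      (Z (φ.symm (φ y))) := rfl
    rw [φ.left_inv hy] at a
    let D : E →L[ℝ] E := mfderiv[Set.range 𝓘(ℝ, E)] φ.symm (φ y)
    have hD : D.IsInvertible :=
      isInvertible_mfderivWithin_extChartAt_symm (I := 𝓘(ℝ, E)) (φ.map_source hy)
    have b : D (mfderiv 𝓘(ℝ, E) 𝓘(ℝ, E) φ y (Z y)) = Z y :=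
      congrArg (fun (L : E →L[ℝ] E) ↦ L (Z y))
        (mfderivWithin_extChartAt_symm_comp_mfderiv_extChartAt' (I := 𝓘(ℝ, E)) hy :
          (_ : E →L[ℝ] E) = _)
    rw [a]
    exact hD.inverse_apply_eq.2 b.symm
  have hrepd {Z : Π y : M, TangentSpace 𝓘(ℝ, E) y}
      (hZ : ContMDiffAt 𝓘(ℝ, E) 𝓘(ℝ, E).tangent ∞
        (fun y ↦ (⟨y, Z y⟩ : TangentBundle 𝓘(ℝ, E) M)) x) : DifferentiableAt ℝ (rep Z) (φ x) := by
    have a := MDifferentiableWithinAt.differentiableWithinAt_mpullbackWithin_vectorField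
      (mdifferentiableWithinAt_univ.2 (hZ.mdifferentiableAt (by simp)))
    rw [← differentiableWithinAt_univ]
    simpa [rep, hφ] using a
  have hfφ {y : M} (hy : y ∈ φ.source) : f =ᶠ[𝓝 y] f' ∘ φ := by
    filter_upwards [extChartAt_source_mem_nhds' hy] with z hz
    simp [f', φ.left_inv hz]
  have hfirst (Z : Π y : M, TangentSpace 𝓘(ℝ, E) y) :
      (fun y ↦ mvfderiv 𝓘(ℝ, E) f y (Z y)) =ᶠ[𝓝 x] (fun p ↦ fderiv ℝ f' p (rep Z p)) ∘ φ := by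
    filter_upwards [extChartAt_source_mem_nhds (I := 𝓘(ℝ, E)) x,
      (continuousAt_extChartAt (I := 𝓘(ℝ, E)) x).eventually hf'd] with y hy hd
    rw [mvfderiv_congr (hfφ hy), hchain hy hd, Function.comp, hrep Z hy]
  have hx : x ∈ φ.source := mem_extChartAt_source x
  have hsecond {Z W : Π y : M, TangentSpace 𝓘(ℝ, E) y}
      (hZ : ContMDiffAt 𝓘(ℝ, E) 𝓘(ℝ, E).tangent ∞
        (fun y ↦ (⟨y, Z y⟩ : TangentBundle 𝓘(ℝ, E) M)) x) :
      mvfderiv 𝓘(ℝ, E) (fun y ↦ mvfderiv 𝓘(ℝ, E) f y (Z y)) x (W x) =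
        fderiv ℝ (fderiv ℝ f') (φ x) (rep W (φ x)) (rep Z (φ x)) +
          fderiv ℝ f' (φ x) (fderiv ℝ (rep Z) (φ x) (rep W (φ x))) := by
    rw [mvfderiv_congr (hfirst Z), hchain hx (hf'2.clm_apply (hrepd hZ)), ← hrep W hx,
      fderiv_clm_apply hf'2 (hrepd hZ)]
    simp [add_comm]
  have hsymm : IsSymmSndFDerivAt ℝ f' (φ x) :=
    hf'.isSymmSndFDerivAt (by simpa using ENat.LEInfty.out)
  rw [hsecond hY, hsecond hX, hsymm.eq (rep X (φ x)) (rep Y (φ x)), mvfderiv_congr (hfφ hx),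
    hchain hx hf'd.self_of_nhds]
  have hbr : mfderiv 𝓘(ℝ, E) 𝓘(ℝ, E) φ x (VectorField.mlieBracket 𝓘(ℝ, E) X Y x) =
      VectorField.lieBracket ℝ (rep X) (rep Y) (φ x) := by
    let D : E →L[ℝ] E := mfderiv 𝓘(ℝ, E) 𝓘(ℝ, E) φ x
    have hD : D.IsInvertible := isInvertible_mfderiv_extChartAt (I := 𝓘(ℝ, E)) hx
    have hu : VectorField.lieBracketWithin ℝ (rep X) (rep Y)
        (φ.symm ⁻¹' Set.univ ∩ Set.range 𝓘(ℝ, E)) (φ x) =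
        VectorField.lieBracket ℝ (rep X) (rep Y) (φ x) := by
      rw [← VectorField.lieBracketWithin_univ]
      simp
    refine (hD.inverse_apply_eq.1 ?_).symm
    rw [← hu, ← VectorField.mlieBracketWithin_univ, VectorField.mlieBracketWithin_apply]
    rfl
  rw [hbr, VectorField.lieBracket, map_sub]
  abel

/-- The coordinates of tangent vectors in the trivialization of the tangent bundle around `q₀`. -/
def coord [IsManifold 𝓘(ℝ, F) ∞ N] (q₀ q : N) : TangentSpace 𝓘(ℝ, F) q →L[ℝ] F :=
  (trivializationAt F (TangentSpace 𝓘(ℝ, F) : N → Type _) q₀).continuousLinearMapAt ℝ q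

/-- The tangent vector with given coordinates in the trivialization around `q₀`. -/
def coordSymm [IsManifold 𝓘(ℝ, F) ∞ N] (q₀ q : N) : F →L[ℝ] TangentSpace 𝓘(ℝ, F) q :=
  (trivializationAt F (TangentSpace 𝓘(ℝ, F) : N → Type _) q₀).symmL ℝ q

theorem mem_chart_source_eventually {H : Type*} [TopologicalSpace H] {B : Type*}
    [TopologicalSpace B] [ChartedSpace H B] (b : B) : ∀ᶠ q in 𝓝 b, q ∈ (chartAt H b).source :=
  (chartAt H b).open_source.mem_nhds (mem_chart_source H b)

/-! ### Fields read in a fixed trivialization of the tangent bundle. -/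

section Coord

variable [IsManifold 𝓘(ℝ, F) ∞ N]

theorem trivializationAt_snd {q₀ q : N} (hq : q ∈ (chartAt F q₀).source)
    (v : TangentSpace 𝓘(ℝ, F) q) :
    (trivializationAt F (TangentSpace 𝓘(ℝ, F) : N → Type _) q₀ ⟨q, v⟩).2 = coord q₀ q v := by
  rw [coord, Trivialization.continuousLinearMapAt_apply, Trivialization.coe_linearMapAt_of_mem _ hq]

theorem trivializationAt_symm {q₀ q : N} (hq : q ∈ (chartAt F q₀).source) (z : F) :
    (trivializationAt F (TangentSpace 𝓘(ℝ, F) : N → Type _) q₀).symm q z = coordSymm q₀ q z := by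
  rw [coordSymm, Trivialization.symmL_apply _ hq]

theorem coord_coordSymm {q₀ q : N} (hq : q ∈ (chartAt F q₀).source) (z : F) :
    coord q₀ q (coordSymm q₀ q z) = z :=
  Trivialization.continuousLinearMapAt_symmL _ hq z

theorem coordSymm_coord {q₀ q : N} (hq : q ∈ (chartAt F q₀).source) (v : TangentSpace 𝓘(ℝ, F) q) :
    coordSymm q₀ q (coord q₀ q v) = v :=
  Trivialization.symmL_continuousLinearMapAt _ hq v

theorem coord_injective {q₀ q : N} (hq : q ∈ (chartAt F q₀).source) :
    Function.Injective (coord q₀ q : TangentSpace 𝓘(ℝ, F) q →L[ℝ] F) :=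
  fun v w h ↦ by rw [← coordSymm_coord hq v, h, coordSymm_coord hq]

theorem contMDiffAt_along_iff {ι : M → N} {q₀ : N} {x : M} {V : Π y : M, TangentSpace 𝓘(ℝ, F) (ι y)}
    (hx : ι x ∈ (chartAt F q₀).source) (hι : ContMDiffAt 𝓘(ℝ, E) 𝓘(ℝ, F) ∞ ι x) :
    ContMDiffAt 𝓘(ℝ, E) 𝓘(ℝ, F).tangent ∞ (fun y ↦ (⟨ι y, V y⟩ : TangentBundle 𝓘(ℝ, F) N)) x ↔
      ContMDiffAt 𝓘(ℝ, E) 𝓘(ℝ, F) ∞ (fun y ↦ coord q₀ (ι y) (V y)) x := by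
  rw [(trivializationAt F (TangentSpace 𝓘(ℝ, F) : N → Type _) q₀).contMDiffAt_iff
    (by simpa using hx)]
  refine (and_iff_right hι).trans (Filter.EventuallyEq.contMDiffAt_iff ?_)
  filter_upwards [hι.continuousAt.eventually ((chartAt F q₀).open_source.mem_nhds hx)] with y hy
  exact trivializationAt_snd hy _

theorem mdifferentiableAt_along_iff {ι : M → N} {q₀ : N} {x : M}
    {V : Π y : M, TangentSpace 𝓘(ℝ, F) (ι y)}
    (hx : ι x ∈ (chartAt F q₀).source) (hι : MDifferentiableAt 𝓘(ℝ, E) 𝓘(ℝ, F) ι x) :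
    MDifferentiableAt 𝓘(ℝ, E) 𝓘(ℝ, F).tangent
        (fun y ↦ (⟨ι y, V y⟩ : TangentBundle 𝓘(ℝ, F) N)) x ↔
      MDifferentiableAt 𝓘(ℝ, E) 𝓘(ℝ, F) (fun y ↦ coord q₀ (ι y) (V y)) x := by
  rw [(trivializationAt F (TangentSpace 𝓘(ℝ, F) : N → Type _) q₀).mdifferentiableAt_totalSpace_iff
    𝓘(ℝ, F) _ (by simpa using hx)]
  refine (and_iff_right hι).trans (Filter.EventuallyEq.mdifferentiableAt_iff ?_)
  filter_upwards [hι.continuousAt.eventually ((chartAt F q₀).open_source.mem_nhds hx)] with y hy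
  exact trivializationAt_snd hy _

/-- A bump function times the local field with constant coordinates. Curvature, admissibility and
umbilicity are stated for global fields, so local frames and single vectors have to be extended. -/
theorem exists_smoothField_coord [FiniteDimensional ℝ F] [T2Space N] (q₀ : N) (z : F) :
    ∃ Z : Π q : N, TangentSpace 𝓘(ℝ, F) q, IsSmoothField Z ∧
      ∀ᶠ q in 𝓝 q₀, Z q = coordSymm q₀ q z := by
  obtain ⟨f⟩ := (inferInstance : Nonempty (SmoothBumpFunction 𝓘(ℝ, F) q₀))
  refine ⟨(f : N → ℝ) • fun q ↦ coordSymm q₀ q z, ?_, ?_⟩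
  · refine ContMDiffOn.smul_section_of_tsupport f.contMDiff.contMDiffOn (chartAt F q₀).open_source
      f.tsupport_subset_chartAt_source fun q hq ↦ ContMDiffAt.contMDiffWithinAt ?_
    refine (contMDiffAt_along_iff (ι := fun p : N ↦ p) (q₀ := q₀) hq contMDiffAt_id).2 ?_
    refine (contMDiffAt_const (c := z)).congr_of_eventuallyEq ?_
    filter_upwards [(chartAt F q₀).open_source.mem_nhds hq] with p hp using coord_coordSymm hp z
  · filter_upwards [f.eventuallyEq_one] with q hq
    simp [hq]

theorem exists_smoothField [FiniteDimensional ℝ F] [T2Space N] (q₀ : N)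
    (v : TangentSpace 𝓘(ℝ, F) q₀) :
    ∃ Z : Π q : N, TangentSpace 𝓘(ℝ, F) q, IsSmoothField Z ∧ Z q₀ = v := by
  obtain ⟨Z, hZ, h⟩ := exists_smoothField_coord q₀ (coord q₀ q₀ v)
  exact ⟨Z, hZ, h.self_of_nhds.trans (coordSymm_coord (mem_chart_source F q₀) v)⟩

theorem coord_eq_mfderiv {q₀ q : N} (hq : q ∈ (chartAt F q₀).source) :
    coord q₀ q = mfderiv 𝓘(ℝ, F) 𝓘(ℝ, F) (extChartAt 𝓘(ℝ, F) q₀) q :=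
  TangentBundle.continuousLinearMapAt_trivializationAt hq

end Coord

end

/-! ### Connection forms -/

section

variable [IsManifold 𝓘(ℝ, E) ∞ M] [IsManifold 𝓘(ℝ, F) ∞ N]

/-- `Γ` is the connection form of `nabla` near `q₀`: in the trivialization around `q₀` one has
`∇_u V = dV(u) + Γ(V)(u)`. -/
structure IsConnectionForm
    (nabla : CovariantDerivative 𝓘(ℝ, F) F (TangentSpace 𝓘(ℝ, F) : N → Type _)) (q₀ : N)
    (Γ : N → F →L[ℝ] F →L[ℝ] F) : Prop where
  contMDiffAt : ContMDiffAt 𝓘(ℝ, F) 𝓘(ℝ, F →L[ℝ] F →L[ℝ] F) ∞ Γ q₀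
  eventually : ∀ᶠ q in 𝓝 q₀, ∀ V : Π p : N, TangentSpace 𝓘(ℝ, F) p,
    MDifferentiableAt 𝓘(ℝ, F) 𝓘(ℝ, F).tangent (fun p ↦ (⟨p, V p⟩ : TangentBundle 𝓘(ℝ, F) N)) q →
    ∀ u : TangentSpace 𝓘(ℝ, F) q, coord q₀ q (nabla V q u) =
      mvfderiv 𝓘(ℝ, F) (fun p ↦ coord q₀ p (V p)) q u + Γ q (coord q₀ q (V q)) (coord q₀ q u)

theorem covariantDerivative_sum_smul
    (nabla : CovariantDerivative 𝓘(ℝ, F) F (TangentSpace 𝓘(ℝ, F) : N → Type _)) {κ : Type*}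
    (s : Finset κ) (f : κ → N → ℝ) (Z : κ → Π q : N, TangentSpace 𝓘(ℝ, F) q) {q : N}
    (hf : ∀ i, MDifferentiableAt 𝓘(ℝ, F) 𝓘(ℝ, ℝ) (f i) q)
    (hZ : ∀ i, MDifferentiableAt 𝓘(ℝ, F) 𝓘(ℝ, F).tangent
      (fun p ↦ (⟨p, Z i p⟩ : TangentBundle 𝓘(ℝ, F) N)) q) :
    MDifferentiableAt 𝓘(ℝ, F) 𝓘(ℝ, F).tangent
      (fun p ↦ (⟨p, (∑ i ∈ s, f i • Z i) p⟩ : TangentBundle 𝓘(ℝ, F) N)) q ∧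
    ∀ u, nabla (∑ i ∈ s, f i • Z i) q u =
      ∑ i ∈ s, (f i q • nabla (Z i) q u + mvfderiv 𝓘(ℝ, F) (f i) q u • Z i q) := by
  classical
  induction s using Finset.induction_on with
  | empty =>
    refine ⟨?_, fun u ↦ by simp⟩
    simpa [zeroSection] using! (mdifferentiable_zeroSection ℝ (TangentSpace 𝓘(ℝ, F) : N → Type _)) q
  | insert i s hi ih =>
    have hs := (hf i).smul_section (hZ i)
    simp only [Finset.sum_insert hi]
    refine ⟨mdifferentiableAt_add_section hs ih.1, fun u ↦ ?_⟩
    rw [nabla.isCovariantDerivativeOnUniv.add hs ih.1,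
      nabla.isCovariantDerivativeOnUniv.leibniz (hZ i) (hf i), add_apply, ih.2]
    rfl

/-- Near `q₀` the fields `Z i` form a frame with constant coordinates, and `V = ∑ f_i Z_i`. The
Leibniz rule splits `∇V` into the derivative of the coordinates and `∑ f_i ∇Z_i`; the latter is `Γ`.
-/
theorem exists_isConnectionForm [FiniteDimensional ℝ F] [T2Space N]
    (nabla : CovariantDerivative 𝓘(ℝ, F) F (TangentSpace 𝓘(ℝ, F) : N → Type _))
    (hnabla : nabla.ContMDiffCovariantDerivative ∞) (q₀ : N) :
    ∃ Γ, IsConnectionForm nabla q₀ Γ := by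
  let b := Module.finBasis ℝ F
  choose Z hZs hZ using fun i ↦ exists_smoothField_coord q₀ (b i)
  let A (i) (q : N) : F →L[ℝ] F := coord q₀ q ∘L nabla (Z i) q ∘L coordSymm q₀ q
  let β (i) : F →L[ℝ] ℝ := LinearMap.toContinuousLinearMap (b.coord i)
  refine ⟨fun q ↦ ∑ i, (β i).smulRight (A i q), ?_, ?_⟩
  · refine contMDiffAt_finsetSum fun i _ ↦ ?_
    have h1 : ContMDiffAt 𝓘(ℝ, F) 𝓘(ℝ, F →L[ℝ] F) ∞ (A i) q₀ := by
      have h := hnabla.contMDiff.contMDiff (σ := Z i) (hZs i).contMDiffOn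
      have h' := ((contMDiffAt_hom_bundle _).1 (h.contMDiffAt (x := q₀) Filter.univ_mem)).2
      exact h'
    exact contMDiffAt_smulRight (β i) h1
  · filter_upwards [Filter.eventually_all.2 fun i ↦ (hZ i).eventually_nhds,
      (mem_chart_source_eventually (H := F) q₀)] with q hq hqs V hV u
    have hv : MDifferentiableAt 𝓘(ℝ, F) 𝓘(ℝ, F) (fun p ↦ coord q₀ p (V p)) q :=
      (mdifferentiableAt_along_iff (ι := fun p : N ↦ p) hqs mdifferentiableAt_id).1 hV
    let f (i) (p : N) : ℝ := β i (coord q₀ p (V p))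
    have hf (i) : MDifferentiableAt 𝓘(ℝ, F) 𝓘(ℝ, ℝ) (f i) q :=
      (β i).differentiableAt.mdifferentiableAt.comp q hv
    have hdf (i) (u : TangentSpace 𝓘(ℝ, F) q) : mvfderiv 𝓘(ℝ, F) (f i) q u =
        β i (mvfderiv 𝓘(ℝ, F) (fun p ↦ coord q₀ p (V p)) q u) :=
      mvfderiv_clm_comp (β i) hv u
    have hsum := covariantDerivative_sum_smul nabla Finset.univ f Z hf
      fun i ↦ ((hZs i) q).mdifferentiableAt (by simp)
    have hVeq : ∀ᶠ p in 𝓝 q, V p = (∑ i, f i • Z i) p := by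
      filter_upwards [Filter.eventually_all.2 hq,
        (chartAt F q₀).open_source.mem_nhds hqs] with p hp hps
      apply coord_injective hps
      simp only [Finset.sum_apply, Pi.smul_apply', hp, map_sum, map_smul, coord_coordSymm hps]
      exact (b.sum_repr _).symm
    rw [nabla.isCovariantDerivativeOnUniv.congr_of_eventuallyEq hV hsum.1 Filter.univ_mem hVeq,
      hsum.2 u]
    have hq' (i) := (hq i).self_of_nhds
    simp only [map_sum, map_add, map_smul, Finset.sum_add_distrib, hq', coord_coordSymm hqs, hdf]
    rw [add_comm]
    congr 1
    · exact b.sum_repr _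
    · simp [f, A, coordSymm_coord hqs]

end

/-! ### Covariant derivatives along maps -/

section

variable [IsManifold 𝓘(ℝ, E) ∞ M] [IsManifold 𝓘(ℝ, F) ∞ N]

theorem contMDiffAt_coord_comp_coordSymm {q₀ q : N} (hq : q ∈ (chartAt F q₀).source) :
    ContMDiffAt 𝓘(ℝ, F) 𝓘(ℝ, F →L[ℝ] F) ∞
      (fun p ↦ (coord q₀ p : TangentSpace 𝓘(ℝ, F) p →L[ℝ] F) ∘L coordSymm q p) q := by
  have h := contMDiffAt_coordChangeL (n := ∞) (IB := 𝓘(ℝ, F))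
    (e := trivializationAt F (TangentSpace 𝓘(ℝ, F) : N → Type _) q)
    (e' := trivializationAt F (TangentSpace 𝓘(ℝ, F) : N → Type _) q₀)
    (x := q) (mem_chart_source F q) hq
  refine h.congr_of_eventuallyEq ?_
  filter_upwards [(chartAt F q₀).open_source.mem_nhds hq, mem_chart_source_eventually (H := F) q]
    with p hp hp'
  ext z
  rw [ContinuousLinearMap.comp_apply, ← trivializationAt_snd hp, ← trivializationAt_symm hp']
  exact (Trivialization.coordChangeL_apply _ _ ⟨hp', hp⟩ z).symm

omit [IsManifold 𝓘(ℝ, E) ∞ M] in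
-- At `y`, `covAlong` is defined by the trivialization around `ι y`, which moves with `y`; a second
-- derivative needs one trivialization for all nearby `y`. Changing it produces a derivative of the
-- transition map `T`, and the same term appears in the covariant derivative of the
-- constant-coordinate field `σ`.
theorem IsConnectionForm.coord_covAlong
    {nabla : CovariantDerivative 𝓘(ℝ, F) F (TangentSpace 𝓘(ℝ, F) : N → Type _)}
    {ι : M → N} (hι : ContMDiff 𝓘(ℝ, E) 𝓘(ℝ, F) ∞ ι) {x : M} {Γ : N → F →L[ℝ] F →L[ℝ] F}
    (hΓ : IsConnectionForm nabla (ι x) Γ) :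
    ∀ᶠ y in 𝓝 x, ∀ V : Π z : M, TangentSpace 𝓘(ℝ, F) (ι z),
      MDifferentiableAt 𝓘(ℝ, E) 𝓘(ℝ, F).tangent
        (fun z ↦ (⟨ι z, V z⟩ : TangentBundle 𝓘(ℝ, F) N)) y → ∀ u : TangentSpace 𝓘(ℝ, E) y,
      coord (ι x) (ι y) (covAlong nabla ι V y u) =
        mvfderiv 𝓘(ℝ, E) (fun z ↦ coord (ι x) (ι z) (V z)) y u +
          Γ (ι y) (coord (ι x) (ι y) (V y))
            (coord (ι x) (ι y) (mfderiv 𝓘(ℝ, E) 𝓘(ℝ, F) ι y u)) := by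
  filter_upwards [hι.continuous.continuousAt.eventually hΓ.eventually,
    hι.continuous.continuousAt.eventually (mem_chart_source_eventually (H := F) (ι x))]
    with y hy hys V hV u
  have hιy : MDifferentiableAt 𝓘(ℝ, E) 𝓘(ℝ, F) ι y := (hι y).mdifferentiableAt (by simp)
  have hself : ι y ∈ (chartAt F (ι y)).source := mem_chart_source F (ι y)
  have hsource := mem_chart_source_eventually (H := F) (ι y)
  let e := trivializationAt F (TangentSpace 𝓘(ℝ, F) : N → Type _) (ι y)
  let c : M → F := fun z ↦ coord (ι y) (ι z) (V z)
  let T : N → F →L[ℝ] F := fun p ↦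
    (coord (ι x) p : TangentSpace 𝓘(ℝ, F) p →L[ℝ] F) ∘L coordSymm (ι y) p
  have hT : MDifferentiableAt 𝓘(ℝ, F) 𝓘(ℝ, F →L[ℝ] F) T (ι y) :=
    (contMDiffAt_coord_comp_coordSymm hys).mdifferentiableAt (by simp)
  have hc : MDifferentiableAt 𝓘(ℝ, E) 𝓘(ℝ, F) c y := (mdifferentiableAt_along_iff hself hιy).1 hV
  have hce : (fun z ↦ (e (⟨ι z, V z⟩ : TangentBundle 𝓘(ℝ, F) N)).2) =ᶠ[𝓝 y] c := by
    filter_upwards [hι.continuous.continuousAt.eventually hsource] with z hz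
      using trivializationAt_snd hz _
  let σ : Π p : N, TangentSpace 𝓘(ℝ, F) p := fun p ↦ e.symm p (c y)
  have hσe : ∀ᶠ p in 𝓝 (ι y), σ p = coordSymm (ι y) p (c y) := by
    filter_upwards [hsource] with p hp using trivializationAt_symm hp _
  have hσ : MDifferentiableAt 𝓘(ℝ, F) 𝓘(ℝ, F).tangent
      (fun p ↦ (⟨p, σ p⟩ : TangentBundle 𝓘(ℝ, F) N)) (ι y) := by
    refine (mdifferentiableAt_along_iff (ι := fun p : N ↦ p) hself mdifferentiableAt_id).2 ?_
    refine (mdifferentiableAt_const (c := c y)).congr_of_eventuallyEq ?_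
    filter_upwards [hsource, hσe] with p hp hp'
    rw [hp', coord_coordSymm hp]
  have hcov : covAlong nabla ι V y u = coordSymm (ι y) (ι y) (mvfderiv 𝓘(ℝ, E) c y u) +
      nabla σ (ι y) (mfderiv 𝓘(ℝ, E) 𝓘(ℝ, F) ι y u) := by
    rw [← trivializationAt_symm hself, ← mvfderiv_congr hce]
    simp only [σ, ← hce.eq_of_nhds]
    rfl
  have hσ1 : mvfderiv 𝓘(ℝ, F) (fun p ↦ coord (ι x) p (σ p)) (ι y)
      (mfderiv 𝓘(ℝ, E) 𝓘(ℝ, F) ι y u) =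
      mvfderiv 𝓘(ℝ, F) T (ι y) (mfderiv 𝓘(ℝ, E) 𝓘(ℝ, F) ι y u) (c y) := by
    refine Eq.trans ?_ (mvfderiv_clm_comp (ContinuousLinearMap.apply ℝ F (c y)) hT _)
    congr 1
    apply mvfderiv_congr
    filter_upwards [hσe] with p hp
    rw [hp]
    rfl
  have hV1 : mvfderiv 𝓘(ℝ, E) (fun z ↦ coord (ι x) (ι z) (V z)) y u =
      mvfderiv 𝓘(ℝ, F) T (ι y) (mfderiv 𝓘(ℝ, E) 𝓘(ℝ, F) ι y u) (c y) +
        T (ι y) (mvfderiv 𝓘(ℝ, E) c y u) := by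
    rw [← mvfderiv_comp_map hT hιy]
    refine Eq.trans ?_ (mvfderiv_clm_apply (hT.comp y hιy) hc u)
    congr 1
    apply mvfderiv_congr
    filter_upwards [hι.continuous.continuousAt.eventually hsource] with z hz
    simp [T, c, coordSymm_coord hz]
  have hσy : σ (ι y) = V y := hσe.self_of_nhds.trans (coordSymm_coord hself _)
  rw [hcov, map_add, hy σ hσ, hσ1, hV1, hσy]
  simp only [T, ContinuousLinearMap.comp_apply]
  abel

end

/-! ### Curvature along maps -/

section

variable [IsManifold 𝓘(ℝ, E) ∞ M] [IsManifold 𝓘(ℝ, F) ∞ N]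

/-- The curvature at `q₀` of the connection with connection form `Γ`, in the coordinates given by
the trivialization around `q₀`. -/
def curvatureForm (Γ : N → F →L[ℝ] F →L[ℝ] F) (q₀ : N) (a b w : F) : F :=
  mvfderiv 𝓘(ℝ, F) Γ q₀ (coordSymm q₀ q₀ a) w b - mvfderiv 𝓘(ℝ, F) Γ q₀ (coordSymm q₀ q₀ b) w a +
    Γ q₀ (Γ q₀ w b) a - Γ q₀ (Γ q₀ w a) b

section

variable {nabla : CovariantDerivative 𝓘(ℝ, F) F (TangentSpace 𝓘(ℝ, F) : N → Type _)}
    {ι : M → N} (hι : ContMDiff 𝓘(ℝ, E) 𝓘(ℝ, F) ∞ ι) {x : M} {Γ : N → F →L[ℝ] F →L[ℝ] F}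
    (hΓ : IsConnectionForm nabla (ι x) Γ)
    {X Y : Π y : M, TangentSpace 𝓘(ℝ, E) y}
    (hX : ContMDiffAt 𝓘(ℝ, E) 𝓘(ℝ, E).tangent ∞
      (fun y ↦ (⟨y, X y⟩ : TangentBundle 𝓘(ℝ, E) M)) x)
    (hY : ContMDiffAt 𝓘(ℝ, E) 𝓘(ℝ, E).tangent ∞
      (fun y ↦ (⟨y, Y y⟩ : TangentBundle 𝓘(ℝ, E) M)) x)
    {V : Π z : M, TangentSpace 𝓘(ℝ, F) (ι z)}
    (hV : ContMDiffAt 𝓘(ℝ, E) 𝓘(ℝ, F).tangent ∞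
        (fun z ↦ (⟨ι z, V z⟩ : TangentBundle 𝓘(ℝ, F) N)) x)

include hι hX in
theorem contMDiffAt_coord_mfderiv :
    ContMDiffAt 𝓘(ℝ, E) 𝓘(ℝ, F) ∞
      (fun y ↦ coord (ι x) (ι y) (mfderiv 𝓘(ℝ, E) 𝓘(ℝ, F) ι y (X y))) x :=
  (contMDiffAt_along_iff (mem_chart_source F (ι x)) (hι x)).1 (contMDiffAt_mfderiv_apply (hι x) hX)

include hι hX hY in
-- The coordinates of `dι u` are the derivative along `u` of the chart composed with `ι`, so this is
-- the bracket formula for that vector-valued function.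
theorem coord_mfderiv_mlieBracket [CompleteSpace E] :
    coord (ι x) (ι x) (mfderiv 𝓘(ℝ, E) 𝓘(ℝ, F) ι x (VectorField.mlieBracket 𝓘(ℝ, E) X Y x)) =
      mvfderiv 𝓘(ℝ, E)
          (fun y ↦ coord (ι x) (ι y) (mfderiv 𝓘(ℝ, E) 𝓘(ℝ, F) ι y (Y y))) x (X x) -
        mvfderiv 𝓘(ℝ, E)
          (fun y ↦ coord (ι x) (ι y) (mfderiv 𝓘(ℝ, E) 𝓘(ℝ, F) ι y (X y))) x (Y x) := by
  let f : M → F := fun y ↦ extChartAt 𝓘(ℝ, F) (ι x) (ι y)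
  have hf : ContMDiffAt 𝓘(ℝ, E) 𝓘(ℝ, F) ∞ f x := contMDiffAt_extChartAt.comp x (hι x)
  have hcoord : ∀ᶠ y in 𝓝 x, ∀ u : TangentSpace 𝓘(ℝ, E) y,
      coord (ι x) (ι y) (mfderiv 𝓘(ℝ, E) 𝓘(ℝ, F) ι y u) = mvfderiv 𝓘(ℝ, E) f y u := by
    filter_upwards [hι.continuous.continuousAt.eventually
      (mem_chart_source_eventually (H := F) (ι x))] with y hy u
    rw [coord_eq_mfderiv hy]
    exact (mvfderiv_comp_map (mdifferentiableAt_extChartAt hy)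
      ((hι y).mdifferentiableAt (by simp)) u).symm
  rw [hcoord.self_of_nhds, mvfderiv_mlieBracket hf hX hY]
  congr 2
  · exact (mvfderiv_congr (hcoord.mono fun y hy ↦ hy (Y y))).symm
  · exact (mvfderiv_congr (hcoord.mono fun y hy ↦ hy (X y))).symm

include hι hΓ hV in
theorem IsConnectionForm.eventually_coord_covAlong (W : Π y : M, TangentSpace 𝓘(ℝ, E) y) :
    ∀ᶠ y in 𝓝 x, coord (ι x) (ι y) (covAlong nabla ι V y (W y)) =
      mvfderiv 𝓘(ℝ, E) (fun z ↦ coord (ι x) (ι z) (V z)) y (W y) +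
        Γ (ι y) (coord (ι x) (ι y) (V y))
            (coord (ι x) (ι y) (mfderiv 𝓘(ℝ, E) 𝓘(ℝ, F) ι y (W y))) := by
  -- Being `C^∞` at a point means `C^n` near it on a neighbourhood that may depend on `n`; one
  -- degree of differentiability is fixed to obtain a neighbourhood.
  have hV1 := (contMDiffAt_iff_contMDiffAt_nhds (n := 1) (by simp)).1
    (hV.of_le (by exact_mod_cast le_top))
  filter_upwards [hΓ.coord_covAlong hι, hV1] with y hy hVy
  exact hy V (hVy.mdifferentiableAt one_ne_zero) (W y)

include hι hΓ hX hV in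
theorem IsConnectionForm.contMDiffAt_covAlong :
    ContMDiffAt 𝓘(ℝ, E) 𝓘(ℝ, F).tangent ∞
        (fun z ↦ (⟨ι z, covAlong nabla ι V z (X z)⟩ : TangentBundle 𝓘(ℝ, F) N)) x := by
  refine (contMDiffAt_along_iff (mem_chart_source F (ι x)) (hι x)).2 ?_
  have hv := (contMDiffAt_along_iff (mem_chart_source F (ι x)) (hι x)).1 hV
  refine ContMDiffAt.congr_of_eventuallyEq ?_ (hΓ.eventually_coord_covAlong hι hV X)
  refine (contMDiffAt_mvfderiv_apply hv hX).add ?_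
  exact ((hΓ.contMDiffAt.comp x (hι x)).clm_apply hv).clm_apply (contMDiffAt_coord_mfderiv hι hX)

include hι hΓ hX hY hV in
-- The structure equation, pulled back. The right side involves only values at `x` and no derivative
-- of `ι` beyond `dι`, so the identity map yields the same expression; this ties the curvature along
-- `ι` to that of `N`.
theorem IsConnectionForm.curvature_along [CompleteSpace E] :
    coord (ι x) (ι x) (covAlong nabla ι (fun y ↦ covAlong nabla ι V y (Y y)) x (X x) -
      covAlong nabla ι (fun y ↦ covAlong nabla ι V y (X y)) x (Y x) -
      covAlong nabla ι V x (VectorField.mlieBracket 𝓘(ℝ, E) X Y x)) =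
    curvatureForm Γ (ι x) (coord (ι x) (ι x) (mfderiv 𝓘(ℝ, E) 𝓘(ℝ, F) ι x (X x)))
      (coord (ι x) (ι x) (mfderiv 𝓘(ℝ, E) 𝓘(ℝ, F) ι x (Y x))) (coord (ι x) (ι x) (V x)) := by
  let v : M → F := fun y ↦ coord (ι x) (ι y) (V y)
  let a (W : Π y : M, TangentSpace 𝓘(ℝ, E) y) : M → F :=
    fun y ↦ coord (ι x) (ι y) (mfderiv 𝓘(ℝ, E) 𝓘(ℝ, F) ι y (W y))
  have hv : ContMDiffAt 𝓘(ℝ, E) 𝓘(ℝ, F) ∞ v x :=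
    (contMDiffAt_along_iff (mem_chart_source F (ι x)) (hι x)).1 hV
  have hιx : MDifferentiableAt 𝓘(ℝ, E) 𝓘(ℝ, F) ι x := (hι x).mdifferentiableAt (by simp)
  have hΓx := hΓ.contMDiffAt.mdifferentiableAt (by simp)
  -- Exchanging `W` and `W'` cancels the two terms with a first derivative of `v` inside `Γ`. The
  -- terms with second derivatives of `v` and with derivatives of `a W` are absorbed by the bracket.
  have hmain {W W' : Π y : M, TangentSpace 𝓘(ℝ, E) y}
      (hW : ContMDiffAt 𝓘(ℝ, E) 𝓘(ℝ, E).tangent ∞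
        (fun y ↦ (⟨y, W y⟩ : TangentBundle 𝓘(ℝ, E) M)) x) :
      coord (ι x) (ι x) (covAlong nabla ι (fun y ↦ covAlong nabla ι V y (W y)) x (W' x)) =
        mvfderiv 𝓘(ℝ, E) (fun y ↦ mvfderiv 𝓘(ℝ, E) v y (W y)) x (W' x) +
        mvfderiv 𝓘(ℝ, F) Γ (ι x) (mfderiv 𝓘(ℝ, E) 𝓘(ℝ, F) ι x (W' x)) (v x) (a W x) +
        Γ (ι x) (mvfderiv 𝓘(ℝ, E) v x (W' x)) (a W x) +
        Γ (ι x) (v x) (mvfderiv 𝓘(ℝ, E) (a W) x (W' x)) +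
        Γ (ι x) (mvfderiv 𝓘(ℝ, E) v x (W x)) (a W' x) +
        Γ (ι x) (Γ (ι x) (v x) (a W x)) (a W' x) := by
    have ha : ContMDiffAt 𝓘(ℝ, E) 𝓘(ℝ, F) ∞ (a W) x := contMDiffAt_coord_mfderiv hι hW
    have h1 := hΓ.eventually_coord_covAlong hι hV W
    have h2 := (hΓ.eventually_coord_covAlong hι (hΓ.contMDiffAt_covAlong hι hW hV) W').self_of_nhds
    have hΓι : MDifferentiableAt 𝓘(ℝ, E) 𝓘(ℝ, F →L[ℝ] F →L[ℝ] F) (fun y ↦ Γ (ι y)) x :=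
      hΓx.comp x hιx
    have hΓv : MDifferentiableAt 𝓘(ℝ, E) 𝓘(ℝ, F →L[ℝ] F) (fun y ↦ Γ (ι y) (v y)) x :=
      hΓι.clm_apply (hv.mdifferentiableAt (by simp))
    have hWv : MDifferentiableAt 𝓘(ℝ, E) 𝓘(ℝ, F) (fun y ↦ mvfderiv 𝓘(ℝ, E) v y (W y)) x :=
      (contMDiffAt_mvfderiv_apply hv hW).mdifferentiableAt (by simp)
    have hΓva : MDifferentiableAt 𝓘(ℝ, E) 𝓘(ℝ, F) (fun y ↦ Γ (ι y) (v y) (a W y)) x :=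
      hΓv.clm_apply (ha.mdifferentiableAt (by simp))
    rw [h2, mvfderiv_congr h1, h1.self_of_nhds]
    have h3 : mvfderiv 𝓘(ℝ, E)
          (fun y ↦ mvfderiv 𝓘(ℝ, E) v y (W y) + Γ (ι y) (v y) (a W y)) x (W' x) =
        mvfderiv 𝓘(ℝ, E) (fun y ↦ mvfderiv 𝓘(ℝ, E) v y (W y)) x (W' x) +
        mvfderiv 𝓘(ℝ, E) (fun y ↦ Γ (ι y) (v y) (a W y)) x (W' x) := by
      rw [← add_apply, ← mvfderiv_add hWv hΓva]
      rfl
    have h4 : mvfderiv 𝓘(ℝ, E) (fun y ↦ Γ (ι y) (v y) (a W y)) x (W' x) =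
        mvfderiv 𝓘(ℝ, E) (fun y ↦ Γ (ι y) (v y)) x (W' x) (a W x) +
          Γ (ι x) (v x) (mvfderiv 𝓘(ℝ, E) (a W) x (W' x)) :=
      mvfderiv_clm_apply hΓv (ha.mdifferentiableAt (by simp)) _
    have h5 : mvfderiv 𝓘(ℝ, E) (fun y ↦ Γ (ι y) (v y)) x (W' x) =
        mvfderiv 𝓘(ℝ, E) (fun y ↦ Γ (ι y)) x (W' x) (v x) +
          Γ (ι x) (mvfderiv 𝓘(ℝ, E) v x (W' x)) :=
      mvfderiv_clm_apply hΓι (hv.mdifferentiableAt (by simp)) _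
    have h6 := mvfderiv_comp_map hΓx hιx (W' x)
    refine (congrArg (· + _) h3).trans ?_
    rw [h4, h5, h6]
    simp only [map_add, add_apply, v, a]
    abel
  have hbr := (hΓ.eventually_coord_covAlong hι hV
    (fun y ↦ VectorField.mlieBracket 𝓘(ℝ, E) X Y y)).self_of_nhds
  rw [map_sub, map_sub, hmain hX, hmain hY, hbr, coord_mfderiv_mlieBracket hι hX hY,
    mvfderiv_mlieBracket hv hX hY, curvatureForm, coordSymm_coord (mem_chart_source F (ι x)),
    coordSymm_coord (mem_chart_source F (ι x))]
  simp only [map_sub, v, a]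
  abel

end

end

/-! ### Algebraic curvature tensors and smoothness of the metric -/

section

section Algebra

variable {T : Type*} [AddCommGroup T]

omit [AddCommGroup T] in
/-- The pair symmetry of algebraic curvature tensors. -/
theorem pair_symm_of_bianchi {K : T → T → T → T → ℝ}
    (hskew : ∀ u v w z, K u v w z = - K v u w z) (hskew' : ∀ u v w z, K u v w z = - K u v z w)
    (hbianchi : ∀ u v w z, K u v w z + K v w u z + K w u v z = 0) (u v w z : T) :
    K u v w z = K w z u v := by
  -- With the Bianchi identities of the four cyclic shifts taken with signs `+ + - -`, skew-symmetry
  -- leaves twice the claim.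
  linarith [hbianchi u v w z, hbianchi v w z u, hbianchi w z u v, hbianchi z u v w,
    hskew u v w z, hskew v w u z, hskew w u v z, hskew' u v w z, hskew' v w u z, hskew' w u v z,
    hskew v w z u, hskew w z v u, hskew z v w u, hskew' v w z u, hskew' w z v u, hskew' z v w u,
    hskew w z u v, hskew z u w v, hskew u w z v, hskew' w z u v, hskew' z u w v, hskew' u w z v,
    hskew z u v w, hskew u v z w, hskew v z u w, hskew' z u v w, hskew' u v z w, hskew' v z u w,
    hskew' w z v u, hskew' u w v z, hskew' z v u w]

/-- An algebraic curvature tensor which vanishes on all `(u, v, v, u)` vanishes. -/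
theorem algebraicCurvature_eq_zero {K : T → T → T → T → ℝ}
    (hadd : ∀ u u' v w z, K (u + u') v w z = K u v w z + K u' v w z)
    (hskew : ∀ u v w z, K u v w z = - K v u w z) (hskew' : ∀ u v w z, K u v w z = - K u v z w)
    (hbianchi : ∀ u v w z, K u v w z + K v w u z + K w u v z = 0)
    (hzero : ∀ u v, K u v v u = 0) (u v w z : T) : K u v w z = 0 := by
  have hpair := pair_symm_of_bianchi hskew hskew' hbianchi
  have hadd2 (u v v' w z : T) : K u (v + v') w z = K u v w z + K u v' w z := by
    rw [hskew, hadd, hskew v, hskew v']; ring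
  have hadd3 (u v w w' z : T) : K u v (w + w') z = K u v w z + K u v w' z := by
    rw [hpair, hadd, hpair w, hpair w']
  have hadd4 (u v w z z' : T) : K u v w (z + z') = K u v w z + K u v w z' := by
    rw [hskew', hadd3, hskew' u v z, hskew' u v z']; ring
  -- Polarization in the outer pair; the next step polarizes in the inner pair.
  have h1 (u v z : T) : K u v v z = 0 := by
    have h := hzero (u + z) v
    rw [hadd, hadd4, hadd4, hzero, hzero] at h
    have h' : K z v v u = K u v v z := by rw [hpair, hskew, hskew', neg_neg]
    linarith
  have h2 (u v w z : T) : K u v w z = - K u w v z := by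
    have h := h1 u (v + w) z
    rw [hadd2, hadd3, hadd3, h1, h1] at h
    linarith
  -- Being skew in the first two and in the middle two slots, `K` is invariant under cyclic shifts
  -- of the first three, so the Bianchi identity says `3 K = 0`.
  linarith [hbianchi u v w z, h2 u v w z, hskew w u v z, hskew v w u z, h2 v w u z, hskew v u w z]

/-- If the sectional curvatures of an algebraic curvature tensor vanish on the nondegenerate planes
then they vanish on all planes. -/
theorem sectional_eq_zero_of_nondegenerate [Module ℝ T] {K : T → T → T → T → ℝ}
    (hadd : ∀ u u' v w z, K (u + u') v w z = K u v w z + K u' v w z)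
    (hsmul : ∀ (a : ℝ) u v w z, K (a • u) v w z = a * K u v w z)
    (hskew : ∀ u v w z, K u v w z = - K v u w z)
    (hpair : ∀ u v w z, K u v w z = K w z u v)
    (B : T →ₗ[ℝ] T →ₗ[ℝ] ℝ)
    (hzero : ∀ u v, B u u * B v v - B u v ^ 2 ≠ 0 → K u v v u = 0)
    {u₀ v₀ : T} (h₀ : B u₀ u₀ * B v₀ v₀ - B u₀ v₀ ^ 2 ≠ 0) (u v : T) : K u v v u = 0 := by
  have hadd2 (u v v' w z : T) : K u (v + v') w z = K u v w z + K u v' w z := by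
    rw [hskew, hadd, hskew v, hskew v']; ring
  have hadd3 (u v w w' z : T) : K u v (w + w') z = K u v w z + K u v w' z := by
    rw [hpair, hadd, hpair w, hpair w']
  have hadd4 (u v w z z' : T) : K u v w (z + z') = K u v w z + K u v w z' := by
    rw [hpair, hadd2, hpair u v w z, hpair u v w z']
  have hsmul2 (a : ℝ) (u v w z : T) : K u (a • v) w z = a * K u v w z := by
    rw [hskew, hsmul, hskew v]; ring
  have hsmul3 (a : ℝ) (u v w z : T) : K u v (a • w) z = a * K u v w z := by
    rw [hpair, hsmul, hpair w]
  have hsmul4 (a : ℝ) (u v w z : T) : K u v w (a • z) = a * K u v w z := by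
    rw [hpair, hsmul2, hpair u v w z]
  -- The segment from `(u, v)` at `t = 0` to the nondegenerate `(u₀, v₀)` at `t = 1`. The Gram
  -- determinant `Q` is analytic and nonzero at `1`, so it has no zero in some punctured
  -- neighbourhood of `0`; there `P` vanishes, and `P 0 = 0` by continuity.
  let Q : ℝ → ℝ := fun t ↦ B (u + t • (u₀ - u)) (u + t • (u₀ - u)) *
    B (v + t • (v₀ - v)) (v + t • (v₀ - v)) - B (u + t • (u₀ - u)) (v + t • (v₀ - v)) ^ 2
  let P : ℝ → ℝ := fun t ↦
    K (u + t • (u₀ - u)) (v + t • (v₀ - v)) (v + t • (v₀ - v)) (u + t • (u₀ - u))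
  have hQ : AnalyticOnNhd ℝ Q Set.univ := by
    intro t _
    simp only [Q, map_add, map_smul, LinearMap.add_apply, LinearMap.smul_apply, smul_eq_mul]
    fun_prop
  have hP : Continuous P := by
    simp only [P, hadd, hadd2, hadd3, hadd4, hsmul, hsmul2, hsmul3, hsmul4]
    fun_prop
  have hP0 : P 0 = K u v v u := by simp [P]
  rw [← hP0]
  rcases (hQ 0 trivial).eventually_eq_zero_or_eventually_ne_zero with h | h
  · have := hQ.eq_of_eventuallyEq (g := 0) (analyticOnNhd_const) h
    have h1 := congrFun this 1
    simp [Q] at h1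
    exact absurd h1 h₀
  · have hev : ∀ᶠ t in 𝓝[≠] (0 : ℝ), P t = 0 := h.mono fun t ht ↦ hzero _ _ ht
    have h1 : Filter.Tendsto P (𝓝[≠] 0) (𝓝 (P 0)) :=
      hP.continuousAt.tendsto.mono_left nhdsWithin_le_nhds
    have h2 : Filter.Tendsto P (𝓝[≠] 0) (𝓝 0) :=
      tendsto_const_nhds.congr' (hev.mono fun t ht ↦ ht.symm)
    exact tendsto_nhds_unique h1 h2

end Algebra

variable [IsManifold 𝓘(ℝ, F) ∞ N]

theorem contMDiffAt_metric (g : SemiRiemannianMetric F N) {ι : M → N}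
    (hι : ContMDiff 𝓘(ℝ, E) 𝓘(ℝ, F) ∞ ι) {x : M} {V W : Π z : M, TangentSpace 𝓘(ℝ, F) (ι z)}
    (hV : ContMDiffAt 𝓘(ℝ, E) 𝓘(ℝ, F).tangent ∞
        (fun z ↦ (⟨ι z, V z⟩ : TangentBundle 𝓘(ℝ, F) N)) x)
    (hW : ContMDiffAt 𝓘(ℝ, E) 𝓘(ℝ, F).tangent ∞
        (fun z ↦ (⟨ι z, W z⟩ : TangentBundle 𝓘(ℝ, F) N)) x) :
    ContMDiffAt 𝓘(ℝ, E) 𝓘(ℝ, ℝ) ∞ (fun z ↦ g.val (ι z) (V z) (W z)) x := by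
  have h := ContMDiffAt.clm_bundle_apply₂ (F₁ := F) (F₂ := F) (F₃ := ℝ)
    (E₁ := (TangentSpace 𝓘(ℝ, F) : N → Type _)) (E₂ := (TangentSpace 𝓘(ℝ, F) : N → Type _))
    (E₃ := Bundle.Trivial N ℝ) (b := ι) (ψ := fun z ↦ g.val (ι z))
    ((g.contMDiff (ι x)).comp x (hι x)) hV hW
  exact (contMDiffAt_totalSpace.1 h).2

end

/-! ### Spaces of constant curvature -/

section

variable [FiniteDimensional ℝ F] [T2Space N] [IsManifold 𝓘(ℝ, F) ∞ N]

omit [FiniteDimensional ℝ F] [T2Space N] in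
theorem IsSmoothField.mdifferentiableAt {X : Π q : N, TangentSpace 𝓘(ℝ, F) q}
    (hX : IsSmoothField X) (q : N) : MDifferentiableAt 𝓘(ℝ, F) 𝓘(ℝ, F).tangent
      (fun p ↦ (⟨p, X p⟩ : TangentBundle 𝓘(ℝ, F) N)) q :=
  (hX q).mdifferentiableAt (by simp)

omit [T2Space N] in
theorem IsSmoothField.mlieBracket {X Y : Π q : N, TangentSpace 𝓘(ℝ, F) q}
    (hX : IsSmoothField X) (hY : IsSmoothField Y) :
    IsSmoothField (VectorField.mlieBracket 𝓘(ℝ, F) X Y) := by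
  have : IsManifold 𝓘(ℝ, F) (minSmoothness ℝ 2) N := by simp; infer_instance
  have : IsManifold 𝓘(ℝ, F) (((⊤ : ℕ∞) : ℕ∞ω) + 1) N := inferInstanceAs (IsManifold 𝓘(ℝ, F) ∞ N)
  exact ContDiff.mlieBracket_vectorField (m := ⊤) (n := ⊤) hX hY (by simp)

/-! ### Ambient curvature as the case of the identity map. -/

section Connection

variable {nabla : CovariantDerivative 𝓘(ℝ, F) F (TangentSpace 𝓘(ℝ, F) : N → Type _)}
  (hnabla : nabla.ContMDiffCovariantDerivative ∞)
  {X Y Z W : Π q : N, TangentSpace 𝓘(ℝ, F) q}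
  (hX : IsSmoothField X) (hY : IsSmoothField Y) (hZ : IsSmoothField Z)

include hnabla in
theorem covAlong_id {q : N} (hX : MDifferentiableAt 𝓘(ℝ, F) 𝓘(ℝ, F).tangent
      (fun p ↦ (⟨p, X p⟩ : TangentBundle 𝓘(ℝ, F) N)) q) (v : TangentSpace 𝓘(ℝ, F) q) :
    covAlong nabla (fun p : N ↦ p) X q v = nabla X q v := by
  obtain ⟨Γ, hΓ⟩ := exists_isConnectionForm nabla hnabla q
  have h1 := (hΓ.coord_covAlong (ι := fun p : N ↦ p) contMDiff_id).self_of_nhds X hX v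
  have h2 := hΓ.eventually.self_of_nhds X hX v
  have h3 : mfderiv 𝓘(ℝ, F) 𝓘(ℝ, F) (fun p : N ↦ p) q v = v :=
    congrArg (fun L : F →L[ℝ] F ↦ L v) (mfderiv_id (I := 𝓘(ℝ, F)) (x := q) : (_ : F →L[ℝ] F) = _)
  rw [h3] at h1
  exact coord_injective (mem_chart_source F q) (h1.trans h2.symm)

include hnabla hX hY in
theorem isSmoothField_covariantDerivative : IsSmoothField fun p ↦ nabla Y p (X p) := by
  intro q
  obtain ⟨Γ, hΓ⟩ := exists_isConnectionForm nabla hnabla q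
  have h := hΓ.contMDiffAt_covAlong (ι := fun p : N ↦ p) contMDiff_id (hX q) (hY q)
  refine h.congr_of_eventuallyEq (Filter.Eventually.of_forall fun p ↦ ?_)
  simp only [covAlong_id hnabla (hY.mdifferentiableAt p)]

include hnabla hX hY hZ in
theorem coord_curvature {q : N} {Γ : N → F →L[ℝ] F →L[ℝ] F} (hΓ : IsConnectionForm nabla q Γ) :
    coord q q (curvature (fun V W p ↦ nabla W p (V p)) X Y Z q) =
      curvatureForm Γ q (coord q q (X q)) (coord q q (Y q)) (coord q q (Z q)) := by
  have h := hΓ.curvature_along (ι := fun p : N ↦ p) contMDiff_id (hX q) (hY q) (hZ q)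
  have h3 (v : TangentSpace 𝓘(ℝ, F) q) : mfderiv 𝓘(ℝ, F) 𝓘(ℝ, F) (fun p : N ↦ p) q v = v :=
    congrArg (fun L : F →L[ℝ] F ↦ L v) (mfderiv_id (I := 𝓘(ℝ, F)) (x := q) : (_ : F →L[ℝ] F) = _)
  have hfun {X : Π q : N, TangentSpace 𝓘(ℝ, F) q} :
      (fun p ↦ covAlong nabla (fun p : N ↦ p) Z p (X p)) =
      fun p ↦ nabla Z p (X p) := by
    funext p
    exact covAlong_id hnabla (hZ.mdifferentiableAt p) _
  rw [h3, h3, hfun, hfun, covAlong_id hnabla (hZ.mdifferentiableAt q),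
    covAlong_id hnabla ((isSmoothField_covariantDerivative hnabla hX hZ).mdifferentiableAt q),
    covAlong_id hnabla ((isSmoothField_covariantDerivative hnabla hY hZ).mdifferentiableAt q)] at h
  exact h

end Connection

/-! ### Symmetries of the Levi-Civita curvature. -/

section LeviCivita

variable {g : SemiRiemannianMetric F N}
  {nabla : CovariantDerivative 𝓘(ℝ, F) F (TangentSpace 𝓘(ℝ, F) : N → Type _)}
  (hnabla : IsLeviCivita g nabla) {X Y Z W : Π q : N, TangentSpace 𝓘(ℝ, F) q}
  (hX : IsSmoothField X) (hY : IsSmoothField Y) (hZ : IsSmoothField Z) (hW : IsSmoothField W)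

include hnabla hX hY hZ hW in
-- Apply `[X,Y] = XY - YX` to the function `g(Z,W)` and expand by metric compatibility: the mixed
-- products of first derivatives cancel.
theorem IsLeviCivita.curvature_skew (q : N) :
    g.val q (curvature (fun V W p ↦ nabla W p (V p)) X Y Z q) (W q) =
      - g.val q (curvature (fun V W p ↦ nabla W p (V p)) X Y W q) (Z q) := by
  have hf {V W : Π q : N, TangentSpace 𝓘(ℝ, F) q} (hV : IsSmoothField V) (hW : IsSmoothField W) :
      ContMDiffAt 𝓘(ℝ, F) 𝓘(ℝ, ℝ) ∞ (fun p ↦ g.val p (V p) (W p)) q :=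
    contMDiffAt_metric g (ι := fun p : N ↦ p) contMDiff_id (hV q) (hW q)
  have hm {V W : Π q : N, TangentSpace 𝓘(ℝ, F) q} (hV : IsSmoothField V) (hW : IsSmoothField W)
      (p : N) := hnabla.metric V W p (hV.mdifferentiableAt p) (hW.mdifferentiableAt p)
  have hs {V W : Π q : N, TangentSpace 𝓘(ℝ, F) q} (hV : IsSmoothField V) (hW : IsSmoothField W) :=
    isSmoothField_covariantDerivative hnabla.smooth hV hW
  have hXY {X Y : Π q : N, TangentSpace 𝓘(ℝ, F) q} (hX : IsSmoothField X) (hY : IsSmoothField Y) :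
      mvfderiv 𝓘(ℝ, F) (fun p ↦ mvfderiv 𝓘(ℝ, F) (fun p ↦ g.val p (Z p) (W p)) p (Y p)) q (X q) =
        g.val q (nabla (fun p ↦ nabla Z p (Y p)) q (X q)) (W q) +
          g.val q (nabla Z q (Y q)) (nabla W q (X q)) +
          (g.val q (nabla Z q (X q)) (nabla W q (Y q)) +
          g.val q (Z q) (nabla (fun p ↦ nabla W p (Y p)) q (X q))) := by
    simp only [hm hZ hW]
    rw [← hm (hs hY hZ) hW, ← hm hZ (hs hY hW), ← add_apply, ← mvfderiv_add
      ((hf (hs hY hZ) hW).mdifferentiableAt (by simp))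
      ((hf hZ (hs hY hW)).mdifferentiableAt (by simp))]
    rfl
  have h := mvfderiv_mlieBracket (hf hZ hW) (hX q) (hY q)
  rw [hXY hX hY, hXY hY hX, hm hZ hW] at h
  rw [g.symm q (curvature (fun V W p ↦ nabla W p (V p)) X Y W q)]
  simp only [curvature, map_sub, sub_apply]
  linarith

include hnabla hX hY hZ in
-- Vanishing torsion turns the cyclic sum into the Jacobi identity for `X`, `Y`, `Z`.
theorem IsLeviCivita.curvature_bianchi (q : N) :
    curvature (fun V W p ↦ nabla W p (V p)) X Y Z q +
      curvature (fun V W p ↦ nabla W p (V p)) Y Z X q +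
      curvature (fun V W p ↦ nabla W p (V p)) Z X Y q = 0 := by
  have ht {V W : Π q : N, TangentSpace 𝓘(ℝ, F) q} (hV : IsSmoothField V) (hW : IsSmoothField W)
      (p : N) : nabla W p (V p) - nabla V p (W p) = VectorField.mlieBracket 𝓘(ℝ, F) V W p :=
    nabla.torsion_eq_zero_iff.1 hnabla.torsion_free (hV.mdifferentiableAt p)
      (hW.mdifferentiableAt p)
  have hs {V W : Π q : N, TangentSpace 𝓘(ℝ, F) q} (hV : IsSmoothField V) (hW : IsSmoothField W) :=
    isSmoothField_covariantDerivative hnabla.smooth hV hW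
  have hd {U V W : Π q : N, TangentSpace 𝓘(ℝ, F) q} (hU : IsSmoothField U) (hV : IsSmoothField V)
      (hW : IsSmoothField W) : nabla (fun p ↦ nabla W p (V p)) q (U q) =
        nabla (fun p ↦ nabla V p (W p)) q (U q) +
          nabla (VectorField.mlieBracket 𝓘(ℝ, F) V W) q (U q) := by
    have heq : (fun p ↦ nabla W p (V p)) = (fun p ↦ nabla V p (W p)) +
        VectorField.mlieBracket 𝓘(ℝ, F) V W := by
      funext p
      exact sub_eq_iff_eq_add'.1 (ht hV hW p)
    rw [heq, nabla.isCovariantDerivativeOnUniv.add ((hs hW hV).mdifferentiableAt q)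
      ((hV.mlieBracket hW).mdifferentiableAt q), add_apply]
  have hj {U V W : Π q : N, TangentSpace 𝓘(ℝ, F) q} (hU : IsSmoothField U) (hV : IsSmoothField V)
      (hW : IsSmoothField W) := ht hU (hV.mlieBracket hW) q
  have hle : minSmoothness ℝ 2 ≤ (∞ : ℕ∞ω) := by
    rw [minSmoothness_of_isRCLikeNormedField]
    exact ENat.LEInfty.out
  have : IsManifold 𝓘(ℝ, F) (minSmoothness ℝ 3) N := by
    rw [minSmoothness_of_isRCLikeNormedField]
    infer_instance
  have hjac := VectorField.leibniz_identity_mlieBracket_apply (I := 𝓘(ℝ, F)) (x := q)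
    ((hX q).of_le hle) ((hY q).of_le hle) ((hZ q).of_le hle)
  rw [VectorField.mlieBracket_swap_apply (V := VectorField.mlieBracket 𝓘(ℝ, F) X Y),
    ← hj hX hY hZ, ← hj hZ hX hY, ← hj hY hX hZ] at hjac
  have hneg : nabla Y q (VectorField.mlieBracket 𝓘(ℝ, F) Z X q) =
      - nabla Y q (VectorField.mlieBracket 𝓘(ℝ, F) X Z q) := by
    rw [VectorField.mlieBracket_swap_apply, map_neg]
  simp only [curvature]
  rw [hd hX hY hZ, hd hY hX hZ, hd hZ hX hY, hneg]
  exact Eq.trans (by abel) (sub_eq_zero.2 hjac)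

end LeviCivita

/-! ### From sectional curvature to the full curvature tensor. -/

section ConstantCurvature

omit [FiniteDimensional ℝ F] [T2Space N] in
theorem curvatureForm_add (Γ : N → F →L[ℝ] F →L[ℝ] F) (q : N) (a a' b w : F) :
    curvatureForm Γ q (a + a') b w = curvatureForm Γ q a b w + curvatureForm Γ q a' b w := by
  let L : F →L[ℝ] F →L[ℝ] F →L[ℝ] F := mvfderiv 𝓘(ℝ, F) Γ q ∘L coordSymm q q
  change L (a + a') w b - L b w (a + a') + Γ q (Γ q w b) (a + a') - Γ q (Γ q w (a + a')) b =
    L a w b - L b w a + Γ q (Γ q w b) a - Γ q (Γ q w a) b +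
      (L a' w b - L b w a' + Γ q (Γ q w b) a' - Γ q (Γ q w a') b)
  rw [L.map_add, (L b w).map_add, (Γ q (Γ q w b)).map_add, (Γ q w).map_add, (Γ q).map_add,
    add_apply, add_apply, add_apply]
  abel

omit [FiniteDimensional ℝ F] [T2Space N] in
theorem curvatureForm_smul (Γ : N → F →L[ℝ] F →L[ℝ] F) (q : N) (r : ℝ) (a b w : F) :
    curvatureForm Γ q (r • a) b w = r • curvatureForm Γ q a b w := by
  let L : F →L[ℝ] F →L[ℝ] F →L[ℝ] F := mvfderiv 𝓘(ℝ, F) Γ q ∘L coordSymm q q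
  change L (r • a) w b - L b w (r • a) + Γ q (Γ q w b) (r • a) - Γ q (Γ q w (r • a)) b =
    r • (L a w b - L b w a + Γ q (Γ q w b) a - Γ q (Γ q w a) b)
  rw [L.map_smul, (L b w).map_smul, (Γ q (Γ q w b)).map_smul, (Γ q w).map_smul, (Γ q).map_smul,
    smul_apply, smul_apply, smul_apply, smul_sub, smul_add, smul_sub]

variable {g : SemiRiemannianMetric F N}
  {nabla : CovariantDerivative 𝓘(ℝ, F) F (TangentSpace 𝓘(ℝ, F) : N → Type _)}

/-- The curvature of a semi-Riemannian manifold of constant sectional curvature `c` at a point where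
there is a nondegenerate tangent plane is `R(u,v)w = c (g(v,w)u - g(u,w)v)`. -/
theorem HasConstantSectionalCurvature.coordSymm_curvatureForm {c : ℝ}
    (hc : HasConstantSectionalCurvature g nabla c) (hnabla : IsLeviCivita g nabla)
    {q : N} {Γ : N → F →L[ℝ] F →L[ℝ] F} (hΓ : IsConnectionForm nabla q Γ)
    {u₀ v₀ : TangentSpace 𝓘(ℝ, F) q}
    (h₀ : g.val q u₀ u₀ * g.val q v₀ v₀ - g.val q u₀ v₀ ^ 2 ≠ 0) (u v w : TangentSpace 𝓘(ℝ, F) q) :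
    coordSymm q q (curvatureForm Γ q (coord q q u) (coord q q v) (coord q q w)) =
      c • (g.val q v w • u - g.val q u w • v) := by
  let R (u v w : TangentSpace 𝓘(ℝ, F) q) : TangentSpace 𝓘(ℝ, F) q :=
    coordSymm q q (curvatureForm Γ q (coord q q u) (coord q q v) (coord q q w))
  -- The deviation from the model tensor. It has all curvature symmetries and vanishes on
  -- nondegenerate planes, hence identically; nondegeneracy of `g` then removes the last slot.
  let K (u v w z : TangentSpace 𝓘(ℝ, F) q) : ℝ :=
    g.val q (R u v w) z - c * (g.val q v w * g.val q u z - g.val q u w * g.val q v z)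
  have hR {X Y Z : Π q : N, TangentSpace 𝓘(ℝ, F) q}
      (hX : IsSmoothField X) (hY : IsSmoothField Y) (hZ : IsSmoothField Z) :
      R (X q) (Y q) (Z q) = curvature (fun V W p ↦ nabla W p (V p)) X Y Z q := by
    simp only [R]
    rw [← coord_curvature hnabla.smooth hX hY hZ hΓ, coordSymm_coord (mem_chart_source F q)]
  have hRadd (u u' v w) : R (u + u') v w = R u v w + R u' v w := by
    simp only [R, map_add, curvatureForm_add]
  have hRsmul (a : ℝ) (u v w) : R (a • u) v w = a • R u v w := by
    simp only [R, map_smul, curvatureForm_smul]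
  have hRskew (u v w) : R u v w = - R v u w := by
    simp only [R, curvatureForm, map_add, map_sub]
    abel
  have hRskew' (u v w z) : g.val q (R u v w) z = - g.val q (R u v z) w := by
    obtain ⟨X, hX, rfl⟩ := exists_smoothField q u
    obtain ⟨Y, hY, rfl⟩ := exists_smoothField q v
    obtain ⟨Z, hZ, rfl⟩ := exists_smoothField q w
    obtain ⟨W, hW, rfl⟩ := exists_smoothField q z
    rw [hR hX hY hZ, hR hX hY hW]
    exact hnabla.curvature_skew hX hY hZ hW q
  have hRbianchi (u v w) : R u v w + R v w u + R w u v = 0 := by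
    obtain ⟨X, hX, rfl⟩ := exists_smoothField q u
    obtain ⟨Y, hY, rfl⟩ := exists_smoothField q v
    obtain ⟨Z, hZ, rfl⟩ := exists_smoothField q w
    rw [hR hX hY hZ, hR hY hZ hX, hR hZ hX hY]
    exact hnabla.curvature_bianchi hX hY hZ q
  have hadd (u u' v w z) : K (u + u') v w z = K u v w z + K u' v w z := by
    simp only [K, hRadd, map_add, add_apply]
    ring
  have hsmul (a : ℝ) (u v w z) : K (a • u) v w z = a * K u v w z := by
    simp only [K, hRsmul, map_smul, smul_apply, smul_eq_mul]
    ring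
  have hskew (u v w z) : K u v w z = - K v u w z := by
    simp only [K]
    rw [hRskew, map_neg, neg_apply]
    ring
  have hskew' (u v w z) : K u v w z = - K u v z w := by
    simp only [K]
    rw [hRskew']
    ring
  have hbianchi (u v w z) : K u v w z + K v w u z + K w u v z = 0 := by
    have h := congrArg (fun x ↦ g.val q x z) (hRbianchi u v w)
    simp only [map_add, add_apply, map_zero, zero_apply] at h
    simp only [K]
    rw [g.symm q v u, g.symm q w v, g.symm q u w]
    linarith
  have hzero (u v) (huv : g.val q u u * g.val q v v - g.val q u v ^ 2 ≠ 0) : K u v v u = 0 := by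
    obtain ⟨X, hX, rfl⟩ := exists_smoothField q u
    obtain ⟨Y, hY, rfl⟩ := exists_smoothField q v
    have h := (div_eq_iff huv).1 (hc X Y hX hY q huv)
    simp only [K]
    rw [hR hX hY hY, h, g.symm q (Y q) (X q)]
    ring
  let B : TangentSpace 𝓘(ℝ, F) q →ₗ[ℝ] TangentSpace 𝓘(ℝ, F) q →ₗ[ℝ] ℝ :=
    ContinuousLinearMap.coeLM ℝ ∘ₗ (g.val q).toLinearMap
  have hK := algebraicCurvature_eq_zero hadd hskew hskew' hbianchi
    (sectional_eq_zero_of_nondegenerate hadd hsmul hskew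
      (pair_symm_of_bianchi hskew hskew' hbianchi) B hzero h₀)
  refine sub_eq_zero.1 (g.nondegenerate q _ fun z ↦ ?_)
  refine Eq.trans ?_ (hK u v w z)
  simp only [K, R, map_sub, map_smul, sub_apply, smul_apply, smul_eq_mul]

end ConstantCurvature

end

/-! ### The transversal decomposition -/

section

variable [IsManifold 𝓘(ℝ, E) ∞ M] [IsManifold 𝓘(ℝ, F) ∞ N]

omit [IsManifold 𝓘(ℝ, E) ∞ M] [IsManifold 𝓘(ℝ, F) ∞ N] in
/-- The differential of an immersion is injective. -/
theorem mfderiv_injective_of_isImmersion {ι : M → N}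
    (hι : Manifold.IsImmersion 𝓘(ℝ, E) 𝓘(ℝ, F) ∞ ι) (x : M) :
    Function.Injective (mfderiv 𝓘(ℝ, E) 𝓘(ℝ, F) ι x) := by
  have hx := hι.isImmersionAt x
  have hdom : hx.domChart.MDifferentiable 𝓘(ℝ, E) 𝓘(ℝ, E) :=
    ⟨(contMDiffOn_of_mem_maximalAtlas hx.domChart_mem_maximalAtlas).mdifferentiableOn (by simp),
      (contMDiffOn_symm_of_mem_maximalAtlas hx.domChart_mem_maximalAtlas).mdifferentiableOn
        (by simp)⟩
  have hcod : MDifferentiableAt 𝓘(ℝ, F) 𝓘(ℝ, F) hx.codChart (ι x) :=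
    ((contMDiffOn_of_mem_maximalAtlas hx.codChart_mem_maximalAtlas).contMDiffAt
      (hx.codChart.open_source.mem_nhds hx.mem_codChart_source)).mdifferentiableAt (by simp)
  -- In charts adapted to the immersion, `ι` is this linear injection.
  let L : E →L[ℝ] F := (hx.equiv : (E × hx.complement) →L[ℝ] F) ∘L ContinuousLinearMap.inl ℝ E _
  have hL : Function.Injective L := hx.equiv.injective.comp (Prod.mk_left_injective 0)
  have heq : (hx.codChart ∘ ι) =ᶠ[𝓝 x] L ∘ hx.domChart := by
    filter_upwards [hx.domChart.open_source.mem_nhds hx.mem_domChart_source] with y hy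
    have hmem : hx.domChart y ∈ (hx.domChart.extend 𝓘(ℝ, E)).target := by
      simpa using hx.domChart.map_source hy
    have := hx.writtenInCharts hmem
    simpa [hx.domChart.left_inv hy, L] using this
  have h1 := heq.mfderiv_eq (I := 𝓘(ℝ, E)) (I' := 𝓘(ℝ, F))
  rw [mfderiv_comp x hcod ((hι.contMDiff x).mdifferentiableAt (by simp)),
    mfderiv_comp x L.differentiableAt.mdifferentiableAt
      (hdom.mdifferentiableAt hx.mem_domChart_source), mfderiv_eq_fderiv, L.fderiv] at h1
  have h2 : Function.Injective (L ∘L (mfderiv 𝓘(ℝ, E) 𝓘(ℝ, E) hx.domChart x : E →L[ℝ] E)) :=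
    hL.comp (hdom.mfderiv_injective hx.mem_domChart_source)
  refine Function.Injective.of_comp (f := mfderiv 𝓘(ℝ, F) 𝓘(ℝ, F) hx.codChart (ι x)) ?_
  intro u v huv
  refine h2 ?_
  have h3 (u : E) := congrArg (fun T : E →L[ℝ] F ↦ T u) (h1 : (_ : E →L[ℝ] F) = _)
  exact (h3 u).symm.trans (huv.trans (h3 v))

omit [IsManifold 𝓘(ℝ, E) ∞ M] in
/-- A linear system with smooth coefficients which is invertible at `x` has a smooth solution
near `x`. -/
theorem exists_contMDiffAt_solution {G : Type*} [NormedAddCommGroup G] [NormedSpace ℝ G]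
    [CompleteSpace G] {G' : Type*} [NormedAddCommGroup G'] [NormedSpace ℝ G']
    {A : M → G →L[ℝ] G'} {r : M → G'} {x : M} (e : G ≃L[ℝ] G') (he : A x = e)
    (hA : ContMDiffAt 𝓘(ℝ, E) 𝓘(ℝ, G →L[ℝ] G') ∞ A x)
    (hr : ContMDiffAt 𝓘(ℝ, E) 𝓘(ℝ, G') ∞ r x) :
    ∃ s : M → G, ContMDiffAt 𝓘(ℝ, E) 𝓘(ℝ, G) ∞ s x ∧
      ∀ᶠ y in 𝓝 x, A y (s y) = r y ∧ ∀ z, A y z = r y → z = s y := by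
  have hinv : ContDiffAt ℝ ∞ ContinuousLinearMap.inverse (A x) := he ▸ contDiffAt_map_inverse e
  refine ⟨fun y ↦ (A y).inverse (r y), (hinv.contMDiffAt.comp x hA).clm_apply hr, ?_⟩
  have hnhds : ∀ᶠ B in 𝓝 (A x), B ∈ Set.range ((↑) : (G ≃L[ℝ] G') → G →L[ℝ] G') :=
    he ▸ ContinuousLinearEquiv.nhds e
  filter_upwards [hA.continuousAt.eventually hnhds] with y hy
  obtain ⟨e', he'⟩ := hy
  simp only [← he', ContinuousLinearMap.inverse_equiv]
  refine ⟨e'.apply_symm_apply _, fun z hz ↦ ?_⟩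
  rw [← hz]
  exact (e'.symm_apply_apply z).symm

section Pointwise

variable {g : SemiRiemannianMetric F N} {ι : M → N}

omit [IsManifold 𝓘(ℝ, E) ∞ M] in
theorem inducedMetric_symm (x : M) (u v : TangentSpace 𝓘(ℝ, E) x) :
    inducedMetric g ι x u v = inducedMetric g ι x v u :=
  g.symm _ _ _

omit [IsManifold 𝓘(ℝ, E) ∞ M] in
theorem inducedMetric_add_left (x : M) (u u' v : TangentSpace 𝓘(ℝ, E) x) :
    inducedMetric g ι x (u + u') v = inducedMetric g ι x u v + inducedMetric g ι x u' v := by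
  simp [inducedMetric]

omit [IsManifold 𝓘(ℝ, E) ∞ M] in
theorem inducedMetric_sub_left (x : M) (u u' v : TangentSpace 𝓘(ℝ, E) x) :
    inducedMetric g ι x (u - u') v = inducedMetric g ι x u v - inducedMetric g ι x u' v := by
  simp [inducedMetric]

omit [IsManifold 𝓘(ℝ, E) ∞ M] in
theorem inducedMetric_smul_left (x : M) (a : ℝ) (u v : TangentSpace 𝓘(ℝ, E) x) :
    inducedMetric g ι x (a • u) v = a * inducedMetric g ι x u v := by
  simp [inducedMetric]

/-- `ξ` spans the radical at `x`, and `n` is the corresponding null section of `tr(TM)`. -/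
structure IsNullPair (S : ScreenDistribution (E := E) g ι) (x : M) (ξ : TangentSpace 𝓘(ℝ, E) x)
    (n : TangentSpace 𝓘(ℝ, F) (ι x)) : Prop where
  span_eq : Submodule.span ℝ {ξ} = radical g ι x
  screen : ∀ s ∈ S.space x, g.val (ι x) (mfderiv 𝓘(ℝ, E) 𝓘(ℝ, F) ι x s) n = 0
  null : g.val (ι x) n n = 0
  pairing : g.val (ι x) (mfderiv 𝓘(ℝ, E) 𝓘(ℝ, F) ι x ξ) n = 1

namespace IsNullPair

variable {S : ScreenDistribution (E := E) g ι} {x : M} {ξ : TangentSpace 𝓘(ℝ, E) x}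
  {n : TangentSpace 𝓘(ℝ, F) (ι x)} (h : IsNullPair S x ξ n)
include h

theorem mem_radical : ξ ∈ radical g ι x :=
  h.span_eq ▸ Submodule.mem_span_singleton_self ξ

theorem metric_mfderiv (u : TangentSpace 𝓘(ℝ, E) x) :
    g.val (ι x) (mfderiv 𝓘(ℝ, E) 𝓘(ℝ, F) ι x u) (mfderiv 𝓘(ℝ, E) 𝓘(ℝ, F) ι x ξ) = 0 := by
  rw [g.symm]
  exact h.mem_radical u

/-- The radical vector is orthogonal to all of `dι(TM)` and has product `1` with `n`, so pairing
with it reads off the coefficient of `n`. Uniqueness of the decomposition and independence of the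
screen both rest on this. -/
theorem metric_add (u : TangentSpace 𝓘(ℝ, E) x) (t : ℝ) :
    g.val (ι x) (mfderiv 𝓘(ℝ, E) 𝓘(ℝ, F) ι x u + t • n) (mfderiv 𝓘(ℝ, E) 𝓘(ℝ, F) ι x ξ) = t := by
  rw [map_add, add_apply, h.metric_mfderiv, map_smul, smul_apply, g.symm, h.pairing]
  simp

/-- The map `(u, t) ↦ dι u + t n` is injective, and both sides have the same dimension because the
codimension is one. -/
theorem exists_decomposition [FiniteDimensional ℝ E] (hι : IsLightlikeHypersurface (E := E) g ι)
    (V : TangentSpace 𝓘(ℝ, F) (ι x)) : ∃ u : TangentSpace 𝓘(ℝ, E) x,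
      V = mfderiv 𝓘(ℝ, E) 𝓘(ℝ, F) ι x u +
        g.val (ι x) V (mfderiv 𝓘(ℝ, E) 𝓘(ℝ, F) ι x ξ) • n := by
  have : FiniteDimensional ℝ F := Module.finite_of_finrank_pos (by rw [hι.codim]; omega)
  let D : E →L[ℝ] F := mfderiv 𝓘(ℝ, E) 𝓘(ℝ, F) ι x
  let n' : F := n
  let Ψ : E × ℝ →ₗ[ℝ] F := D.toLinearMap.coprod (LinearMap.toSpanSingleton ℝ F n')
  have hΨ : Function.Injective Ψ := by
    refine (injective_iff_map_eq_zero Ψ).2 fun ⟨u, t⟩ hut ↦ ?_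
    have h1 : D u + t • n' = 0 := hut
    have h2 : t = 0 := by
      refine (h.metric_add u t).symm.trans ?_
      exact (congrArg (fun V : F ↦ (g.val (ι x) V : F →L[ℝ] ℝ) (D ξ)) h1).trans
        (congrArg (fun T : F →L[ℝ] ℝ ↦ T (D ξ)) (map_zero (g.val (ι x))))
    have h3 : D u = D 0 := by simpa [h2] using h1
    have h4 : u = 0 := mfderiv_injective_of_isImmersion hι.immersion x h3
    rw [h2, h4]
    rfl
  obtain ⟨⟨u, t⟩, hut⟩ := (LinearMap.injective_iff_surjective_of_finrank_eq_finrank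
    (by simp [hι.codim])).1 hΨ V
  refine ⟨u, hut.symm.trans (congrArg (fun r : ℝ ↦ D u + r • n') ?_)⟩
  exact (h.metric_add u t).symm.trans (congrArg (fun V : F ↦ (g.val (ι x) V : F →L[ℝ] ℝ) (D ξ)) hut)

theorem eq_of_decomposition (hι : IsLightlikeHypersurface (E := E) g ι)
    {u u' : TangentSpace 𝓘(ℝ, E) x} {t t' : ℝ}
    (he : mfderiv 𝓘(ℝ, E) 𝓘(ℝ, F) ι x u + t • n = mfderiv 𝓘(ℝ, E) 𝓘(ℝ, F) ι x u' + t' • n) :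
    u = u' ∧ t = t' := by
  have ht : t = t' := by rw [← h.metric_add u t, he, h.metric_add]
  subst ht
  exact ⟨mfderiv_injective_of_isImmersion hι.immersion x (add_right_cancel he), rfl⟩

/-- A generator `m` splits as `s + b ξ + t n` with `t ≠ 0`. Orthogonality to the screen and its
nondegeneracy give `s = 0`; then `g(m,m) = 2bt = 0` gives `b = 0`. -/
theorem transversal_eq [FiniteDimensional ℝ E] (hι : IsLightlikeHypersurface (E := E) g ι) :
    transversal S x = Submodule.span ℝ {n} := by
  apply le_antisymm
  · refine Submodule.span_le.2 ?_
    rintro m ⟨hm, hm0, η, hη, hηm⟩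
    rw [← h.span_eq] at hη
    obtain ⟨a, rfl⟩ := Submodule.mem_span_singleton.1 hη
    obtain ⟨u, hu⟩ := h.exists_decomposition hι m
    set t := g.val (ι x) m (mfderiv 𝓘(ℝ, E) 𝓘(ℝ, F) ι x ξ) with ht
    have hat : a * t = 1 := by
      rw [← hηm, map_smul, map_smul, smul_apply, smul_eq_mul, g.symm, ← ht]
    obtain ⟨s, hs, r, hr, rfl⟩ : ∃ s ∈ S.space x, ∃ r ∈ radical g ι x, s + r = u :=
      Submodule.mem_sup.1 ((S.isCompl x).sup_eq_top ▸ Submodule.mem_top)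
    have hs0 : s = 0 := by
      refine S.nondegenerate x s hs fun v hv ↦ ?_
      have h1 := hm v hv
      rw [hu, map_add, map_smul, h.screen v hv] at h1
      have h2 : inducedMetric g ι x (s + r) v = 0 := by
        rw [inducedMetric_symm]
        simpa only [smul_zero, add_zero] using! h1
      rw [inducedMetric_add_left, show inducedMetric g ι x r v = 0 from hr v, add_zero] at h2
      exact h2
    rw [← h.span_eq] at hr
    obtain ⟨b, rfl⟩ := Submodule.mem_span_singleton.1 hr
    have hb : b = 0 := by
      have h1 := hm0
      rw [hu, hs0, zero_add, map_smul] at h1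
      simp only [map_add, add_apply, map_smul, smul_apply, smul_eq_mul, h.metric_mfderiv,
        g.symm _ n, h.pairing, h.null] at h1
      have h2 : 2 * b * (a * t) = 0 := by linear_combination a * h1
      rw [hat] at h2
      linarith
    rw [hu, hs0, hb]
    simpa using Submodule.smul_mem _ t (Submodule.mem_span_singleton_self n)
  · exact Submodule.span_le.2 (Set.singleton_subset_iff.2
      (Submodule.subset_span ⟨h.screen, h.null, ξ, h.mem_radical, h.pairing⟩))

/-- The choice in `tangentialPart` is meaningful because a decomposition exists; its transversal
coefficient is the product with `ξ`. -/
theorem mfderiv_tangentialPart [FiniteDimensional ℝ E]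
    (hι : IsLightlikeHypersurface (E := E) g ι) (V : TangentSpace 𝓘(ℝ, F) (ι x)) :
    mfderiv 𝓘(ℝ, E) 𝓘(ℝ, F) ι x (tangentialPart S x V) +
      g.val (ι x) V (mfderiv 𝓘(ℝ, E) 𝓘(ℝ, F) ι x ξ) • n = V := by
  have hex : ∃ u, V - mfderiv 𝓘(ℝ, E) 𝓘(ℝ, F) ι x u ∈ transversal S x := by
    obtain ⟨u, hu⟩ := h.exists_decomposition hι V
    refine ⟨u, ?_⟩
    rw [h.transversal_eq hι, sub_eq_iff_eq_add'.2 hu]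
    exact Submodule.smul_mem _ _ (Submodule.mem_span_singleton_self n)
  have h1 := Classical.epsilon_spec hex
  obtain ⟨t, ht⟩ := Submodule.mem_span_singleton.1 ((h.transversal_eq hι).le h1)
  have h2 : V = mfderiv 𝓘(ℝ, E) 𝓘(ℝ, F) ι x (tangentialPart S x V) + t • n :=
    (eq_add_of_sub_eq' ht.symm)
  have h3 : g.val (ι x) V (mfderiv 𝓘(ℝ, E) 𝓘(ℝ, F) ι x ξ) = t := by
    conv_lhs => rw [h2]
    exact h.metric_add _ _
  rw [h3]
  exact h2.symm

end IsNullPair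

end Pointwise

end

/-! ### Smooth null sections -/

section

variable [IsManifold 𝓘(ℝ, E) ∞ M] [IsManifold 𝓘(ℝ, F) ∞ N]
  {g : SemiRiemannianMetric F N} {ι : M → N}

section Along

variable (hι : ContMDiff 𝓘(ℝ, E) 𝓘(ℝ, F) ∞ ι) {x : M} {V W : Π y : M, TangentSpace 𝓘(ℝ, F) (ι y)}
  (hV : ContMDiffAt 𝓘(ℝ, E) 𝓘(ℝ, F).tangent ∞
    (fun y ↦ (⟨ι y, V y⟩ : TangentBundle 𝓘(ℝ, F) N)) x)
  (hW : ContMDiffAt 𝓘(ℝ, E) 𝓘(ℝ, F).tangent ∞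
    (fun y ↦ (⟨ι y, W y⟩ : TangentBundle 𝓘(ℝ, F) N)) x)
  {f : M → ℝ} (hf : ContMDiffAt 𝓘(ℝ, E) 𝓘(ℝ, ℝ) ∞ f x)

omit [IsManifold 𝓘(ℝ, E) ∞ M]

include hι hV hW in
theorem contMDiffAt_along_sub : ContMDiffAt 𝓘(ℝ, E) 𝓘(ℝ, F).tangent ∞
    (fun y ↦ (⟨ι y, V y - W y⟩ : TangentBundle 𝓘(ℝ, F) N)) x := by
  have hx := mem_chart_source F (ι x)
  refine (contMDiffAt_along_iff hx (hι x)).2 ?_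
  simp only [map_sub]
  exact ((contMDiffAt_along_iff hx (hι x)).1 hV).sub ((contMDiffAt_along_iff hx (hι x)).1 hW)

include hι hV hf in
theorem contMDiffAt_along_smul : ContMDiffAt 𝓘(ℝ, E) 𝓘(ℝ, F).tangent ∞
    (fun y ↦ (⟨ι y, f y • V y⟩ : TangentBundle 𝓘(ℝ, F) N)) x := by
  have hx := mem_chart_source F (ι x)
  refine (contMDiffAt_along_iff hx (hι x)).2 ?_
  simp only [map_smul]
  exact hf.smul ((contMDiffAt_along_iff hx (hι x)).1 hV)

end Along

/-- Near every point there are smooth null sections of the radical and of `tr(TM)`. -/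
theorem exists_isNullPair [FiniteDimensional ℝ F] [T2Space N]
    (hι : IsLightlikeHypersurface (E := E) g ι)
    (S : ScreenDistribution (E := E) g ι) (x : M) :
    ∃ (ξ : Π y : M, TangentSpace 𝓘(ℝ, E) y) (n : Π y : M, TangentSpace 𝓘(ℝ, F) (ι y)),
      ContMDiffAt 𝓘(ℝ, E) 𝓘(ℝ, E).tangent ∞
        (fun y ↦ (⟨y, ξ y⟩ : TangentBundle 𝓘(ℝ, E) M)) x ∧
      ContMDiffAt 𝓘(ℝ, E) 𝓘(ℝ, F).tangent ∞
        (fun y ↦ (⟨ι y, n y⟩ : TangentBundle 𝓘(ℝ, F) N)) x ∧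
      ∀ᶠ y in 𝓝 x, IsNullPair S y (ξ y) (n y) := by
  have hιs : ContMDiff 𝓘(ℝ, E) 𝓘(ℝ, F) ∞ ι := hι.immersion.contMDiff
  obtain ⟨U, hU, Ξ, hΞs, hΞ⟩ := hι.radical_smooth x
  obtain ⟨k, hk⟩ := S.smooth
  obtain ⟨U', hU', s, hs, hsp⟩ := hk x
  let dι (y : M) : TangentSpace 𝓘(ℝ, E) y →L[ℝ] TangentSpace 𝓘(ℝ, F) (ι y) :=
    mfderiv 𝓘(ℝ, E) 𝓘(ℝ, F) ι y
  let ξ := Ξ 0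
  have hξ : ContMDiffAt 𝓘(ℝ, E) 𝓘(ℝ, E).tangent ∞
        (fun y ↦ (⟨y, ξ y⟩ : TangentBundle 𝓘(ℝ, E) M)) x := (hΞs 0).contMDiffAt hU
  have hdξ := contMDiffAt_mfderiv_apply (hιs x) hξ
  have hds (i) := contMDiffAt_mfderiv_apply (hιs x) ((hs i).contMDiffAt hU')
  have hspan : ∀ y ∈ U, Submodule.span ℝ {ξ y} = radical g ι y := by
    intro y hy
    rw [← (hΞ y hy).2]
    congr 1
    ext v
    simp [ξ, eq_comm]
  have hrad : ∀ y ∈ U, ∀ u, g.val (ι y) (dι y (ξ y)) (dι y u) = 0 := fun y hy u ↦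
    (hspan y hy ▸ Submodule.mem_span_singleton_self (ξ y) : ξ y ∈ radical g ι y) u
  have hξ0 : dι x (ξ x) ≠ 0 := by
    intro h0
    refine (hΞ x (mem_of_mem_nhds hU)).1.ne_zero 0 ?_
    exact mfderiv_injective_of_isImmersion hι.immersion x (h0.trans (map_zero (dι x)).symm)
  obtain ⟨w, hw⟩ : ∃ w, g.val (ι x) (dι x (ξ x)) w ≠ 0 := by
    by_contra! h
    exact hξ0 (g.nondegenerate _ _ h)
  obtain ⟨W, hW, rfl⟩ := exists_smoothField (ι x) w
  have hWι : ContMDiffAt 𝓘(ℝ, E) 𝓘(ℝ, F).tangent ∞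
        (fun y ↦ (⟨ι y, W (ι y)⟩ : TangentBundle 𝓘(ℝ, F) N)) x := (hW (ι x)).comp x (hιs x)
  -- remove the screen components of `W`
  let A (y : M) : (Fin k → ℝ) →L[ℝ] (Fin k → ℝ) := ∑ j, (ContinuousLinearMap.proj j).smulRight
    (fun i ↦ g.val (ι y) (dι y (s i y)) (dι y (s j y)))
  have hA : ContMDiffAt 𝓘(ℝ, E) 𝓘(ℝ, (Fin k → ℝ) →L[ℝ] (Fin k → ℝ)) ∞ A x := by
    refine contMDiffAt_finsetSum fun j _ ↦ contMDiffAt_smulRight _ ?_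
    exact contMDiffAt_pi_space.2 fun i ↦ contMDiffAt_metric g hιs (hds i) (hds j)
  have hAapply (y : M) (a : Fin k → ℝ) (i : Fin k) :
      A y a i = g.val (ι y) (dι y (s i y)) (dι y (∑ j, a j • s j y)) := by
    simp [A, map_sum]
  -- `A x` is the Gram matrix of the screen frame, invertible since the screen is nondegenerate. Its
  -- solution `a` gives the screen projection `σ` of `W`.
  have hAinj : Function.Injective (A x) := by
    refine (injective_iff_map_eq_zero (A x)).2 fun a ha ↦ ?_
    have hx := hsp x (mem_of_mem_nhds hU')
    have hmem : ∑ j, a j • s j x ∈ S.space x := by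
      rw [← hx.2]
      exact Submodule.sum_mem _ fun j _ ↦ Submodule.smul_mem _ _ (Submodule.subset_span ⟨j, rfl⟩)
    have h0 : ∑ j, a j • s j x = 0 := by
      refine S.nondegenerate x _ hmem fun v hv ↦ ?_
      rw [← hx.2] at hv
      rw [inducedMetric_symm]
      induction hv using Submodule.span_induction with
      | mem v hv =>
        obtain ⟨i, rfl⟩ := hv
        exact (hAapply x a i).symm.trans (congrFun ha i)
      | zero => simp [inducedMetric]
      | add u v _ _ hu hv => rw [inducedMetric_add_left, hu, hv, add_zero]
      | smul r v _ hv => rw [inducedMetric_smul_left, hv, mul_zero]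
    funext i
    exact Fintype.linearIndependent_iff.1 hx.1 a h0 i
  let e : (Fin k → ℝ) ≃L[ℝ] (Fin k → ℝ) :=
    (LinearEquiv.ofInjectiveEndo (A x).toLinearMap hAinj).toContinuousLinearEquiv
  obtain ⟨a, ha, hAa⟩ := exists_contMDiffAt_solution (x := x) e (by ext; rfl) hA
    (r := fun y i ↦ g.val (ι y) (dι y (s i y)) (W (ι y)))
    (contMDiffAt_pi_space.2 fun i ↦ contMDiffAt_metric g hιs (hds i) hWι)
  let σ (y : M) : TangentSpace 𝓘(ℝ, E) y := ∑ j, a y j • s j y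
  have hσ : ContMDiffAt 𝓘(ℝ, E) 𝓘(ℝ, E).tangent ∞
        (fun y ↦ (⟨y, σ y⟩ : TangentBundle 𝓘(ℝ, E) M)) x :=
    ContMDiffAt.sum_section fun j _ ↦
      (contMDiffAt_pi_space.1 ha j).smul_section ((hs j).contMDiffAt hU')
  have hdσ := contMDiffAt_mfderiv_apply (hιs x) hσ
  let θ (y : M) : ℝ := g.val (ι y) (dι y (ξ y)) (W (ι y))
  have hθ : ContMDiffAt 𝓘(ℝ, E) 𝓘(ℝ, ℝ) ∞ θ x := contMDiffAt_metric g hιs hdξ hWι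
  -- Near `x` this is orthogonal to the screen and has product `1` with `ξ`. Subtracting `φ ξ` with
  -- `φ = g(m,m)/2` keeps both properties and makes it null.
  let m (y : M) : TangentSpace 𝓘(ℝ, F) (ι y) := (θ y)⁻¹ • (W (ι y) - dι y (σ y))
  have hm : ContMDiffAt 𝓘(ℝ, E) 𝓘(ℝ, F).tangent ∞
        (fun y ↦ (⟨ι y, m y⟩ : TangentBundle 𝓘(ℝ, F) N)) x := by
    refine contMDiffAt_along_smul hιs (contMDiffAt_along_sub hιs hWι hdσ) ?_
    exact (contDiffAt_inv ℝ hw).contMDiffAt.comp x hθ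
  let φ (y : M) : ℝ := g.val (ι y) (m y) (m y) / 2
  have hφ : ContMDiffAt 𝓘(ℝ, E) 𝓘(ℝ, ℝ) ∞ φ x :=
    (contMDiffAt_metric g hιs hm hm).div_const 2
  refine ⟨ξ, fun y ↦ m y - φ y • dι y (ξ y), hξ,
    contMDiffAt_along_sub hιs hm (contMDiffAt_along_smul hιs hdξ hφ), ?_⟩
  filter_upwards [hU, hU', hAa, hθ.continuousAt.eventually_ne hw] with y hy hy' hay hθy
  have hσξ (u) : g.val (ι y) (dι y u) (dι y (ξ y)) = 0 := by
    rw [g.symm]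
    exact hrad y hy u
  have hmξ : g.val (ι y) (dι y (ξ y)) (m y) = 1 := by
    simp only [m]
    rw [map_smul, map_sub, hrad y hy, sub_zero, smul_eq_mul]
    exact inv_mul_cancel₀ hθy
  refine ⟨hspan y hy, fun v hv ↦ ?_, ?_, ?_⟩
  · change g.val (ι y) (dι y v) _ = 0
    rw [map_sub, (g.val (ι y) (dι y v)).map_smul (φ y), hσξ, smul_zero, sub_zero]
    rw [← (hsp y hy').2] at hv
    induction hv using Submodule.span_induction with
    | mem v hv =>
      obtain ⟨i, rfl⟩ := hv
      have h1 := (hAapply y (a y) i).symm.trans (congrFun hay.1 i)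
      simp only [m, σ]
      rw [map_smul, map_sub, h1, sub_self, smul_zero]
    | zero => simp
    | add u v _ _ hu hv => rw [map_add, map_add, add_apply, hu, hv, add_zero]
    | smul r v _ hv => rw [(dι y).map_smul, (g.val (ι y)).map_smul, smul_apply, hv, smul_zero]
  · simp only [map_sub, sub_apply, map_smul, smul_apply, hσξ, hmξ, g.symm _ (m y) (dι y (ξ y)),
      smul_eq_mul, φ]
    ring
  · change g.val (ι y) (dι y (ξ y)) _ = 1
    rw [map_sub, (g.val (ι y) (dι y (ξ y))).map_smul (φ y), hσξ, smul_zero, sub_zero, hmξ]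

/-- The tangential part is defined by a pointwise choice. It is also the first component of the
unique solution of `dι u + t n = V`, a linear system with smooth coefficients that is invertible at
`x`. -/
theorem tangentialPart_contMDiffAt [FiniteDimensional ℝ E] [FiniteDimensional ℝ F] [T2Space N]
    (hι : IsLightlikeHypersurface (E := E) g ι)
    (S : ScreenDistribution (E := E) g ι) {x : M} {V : Π y : M, TangentSpace 𝓘(ℝ, F) (ι y)}
    (hV : ContMDiffAt 𝓘(ℝ, E) 𝓘(ℝ, F).tangent ∞
      (fun y ↦ (⟨ι y, V y⟩ : TangentBundle 𝓘(ℝ, F) N)) x) :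
    ContMDiffAt 𝓘(ℝ, E) 𝓘(ℝ, E).tangent ∞
      (fun y ↦ (⟨y, tangentialPart S y (V y)⟩ : TangentBundle 𝓘(ℝ, E) M)) x := by
  have hιs : ContMDiff 𝓘(ℝ, E) 𝓘(ℝ, F) ∞ ι := hι.immersion.contMDiff
  obtain ⟨ξ, n, -, hn, h⟩ := exists_isNullPair hι S x
  have hx := mem_chart_source F (ι x)
  have hx' := mem_chart_source E x
  let D (y : M) : E →L[ℝ] F := coord (ι x) (ι y) ∘L mfderiv 𝓘(ℝ, E) 𝓘(ℝ, F) ι y ∘L coordSymm x y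
  have hD : ContMDiffAt 𝓘(ℝ, E) 𝓘(ℝ, E →L[ℝ] F) ∞ D x :=
    (hιs x).mfderiv_const (m := ∞) le_rfl
  let ν (y : M) : F := coord (ι x) (ι y) (n y)
  have hν : ContMDiffAt 𝓘(ℝ, E) 𝓘(ℝ, F) ∞ ν x := (contMDiffAt_along_iff hx (hιs x)).1 hn
  let A (y : M) : E × ℝ →L[ℝ] F := D y ∘L ContinuousLinearMap.fst ℝ E ℝ +
    (ContinuousLinearMap.snd ℝ E ℝ).smulRight (ν y)
  have hA : ContMDiffAt 𝓘(ℝ, E) 𝓘(ℝ, E × ℝ →L[ℝ] F) ∞ A x := by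
    refine ContMDiffAt.add ?_ (contMDiffAt_smulRight _ hν)
    exact contMDiffAt_clm_comp
      ((ContinuousLinearMap.compL ℝ (E × ℝ) E F).flip (ContinuousLinearMap.fst ℝ E ℝ)) hD
  have hAinj : Function.Injective (A x) := by
    refine (injective_iff_map_eq_zero (A x)).2 fun ⟨u, t⟩ hut ↦ ?_
    have h1 : coord (ι x) (ι x) (mfderiv 𝓘(ℝ, E) 𝓘(ℝ, F) ι x (coordSymm x x u) + t • n x) =
        coord (ι x) (ι x) (mfderiv 𝓘(ℝ, E) 𝓘(ℝ, F) ι x 0 + (0 : ℝ) • n x) := by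
      rw [map_add, map_smul, map_zero, zero_smul, add_zero, map_zero]
      exact hut
    have h2 := h.self_of_nhds.eq_of_decomposition hι (coord_injective hx h1)
    rw [h2.2, ← coord_coordSymm hx' u, h2.1, map_zero]
    rfl
  let e : (E × ℝ) ≃L[ℝ] F := (LinearEquiv.ofInjectiveOfFinrankEq (A x).toLinearMap hAinj
    (by simp [hι.codim])).toContinuousLinearEquiv
  obtain ⟨s, hs, hAs⟩ := exists_contMDiffAt_solution (x := x) e (by ext <;> rfl) hA
    ((contMDiffAt_along_iff hx (hιs x)).1 hV)
  refine (contMDiffAt_along_iff (ι := fun y : M ↦ y) hx' contMDiffAt_id).2 ?_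
  refine ContMDiffAt.congr_of_eventuallyEq (contMDiffAt_clm_comp (ContinuousLinearMap.fst ℝ E ℝ) hs)
    ?_
  filter_upwards [hAs, h, mem_chart_source_eventually (H := E) x] with y hy hny hyx
  have h1 := hy.2 (coord x y (tangentialPart S y (V y)),
    g.val (ι y) (V y) (mfderiv 𝓘(ℝ, E) 𝓘(ℝ, F) ι y (ξ y))) (by
      have h2 := congrArg (coord (ι x) (ι y)) (hny.mfderiv_tangentialPart hι (V y))
      rw [map_add, map_smul] at h2
      refine Eq.trans ?_ h2
      change coord (ι x) (ι y) (mfderiv 𝓘(ℝ, E) 𝓘(ℝ, F) ι y (coordSymm x y (coord x y _))) + _ = _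
      rw [coordSymm_coord hyx]
      rfl)
  rw [← h1]
  rfl

end

/-! ### The Gauss equation -/

section

variable [IsManifold 𝓘(ℝ, E) ∞ M] [IsManifold 𝓘(ℝ, F) ∞ N]
  [FiniteDimensional ℝ F] [T2Space N]
  {g : SemiRiemannianMetric F N} {ι : M → N}
  {nabla : CovariantDerivative 𝓘(ℝ, F) F (TangentSpace 𝓘(ℝ, F) : N → Type _)}

omit [IsManifold 𝓘(ℝ, E) ∞ M] in
-- The Leibniz rule in the shape of the Gauss formula. The decomposition is required only near `x`
-- because the transversal section is local.
theorem covAlong_add_smul (hnabla : nabla.ContMDiffCovariantDerivative ∞)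
    (hι : ContMDiff 𝓘(ℝ, E) 𝓘(ℝ, F) ∞ ι) {x : M} {V A B : Π y : M, TangentSpace 𝓘(ℝ, F) (ι y)}
    {f : M → ℝ}
    (hV : ContMDiffAt 𝓘(ℝ, E) 𝓘(ℝ, F).tangent ∞
      (fun y ↦ (⟨ι y, V y⟩ : TangentBundle 𝓘(ℝ, F) N)) x)
    (hA : ContMDiffAt 𝓘(ℝ, E) 𝓘(ℝ, F).tangent ∞
      (fun y ↦ (⟨ι y, A y⟩ : TangentBundle 𝓘(ℝ, F) N)) x)
    (hB : ContMDiffAt 𝓘(ℝ, E) 𝓘(ℝ, F).tangent ∞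
      (fun y ↦ (⟨ι y, B y⟩ : TangentBundle 𝓘(ℝ, F) N)) x)
    (hf : ContMDiffAt 𝓘(ℝ, E) 𝓘(ℝ, ℝ) ∞ f x)
    (heq : ∀ᶠ y in 𝓝 x, V y = A y + f y • B y) (u : TangentSpace 𝓘(ℝ, E) x) :
    covAlong nabla ι V x u = covAlong nabla ι A x u + f x • covAlong nabla ι B x u +
      mvfderiv 𝓘(ℝ, E) f x u • B x := by
  obtain ⟨Γ, hΓ⟩ := exists_isConnectionForm nabla hnabla (ι x)
  have hx := mem_chart_source F (ι x)
  have hcov {V : Π y : M, TangentSpace 𝓘(ℝ, F) (ι y)}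
      (hV : ContMDiffAt 𝓘(ℝ, E) 𝓘(ℝ, F).tangent ∞
        (fun y ↦ (⟨ι y, V y⟩ : TangentBundle 𝓘(ℝ, F) N)) x) :=
    (hΓ.coord_covAlong hι).self_of_nhds V (hV.mdifferentiableAt (by simp)) u
  have ha := ((contMDiffAt_along_iff hx (hι x)).1 hA).mdifferentiableAt (by simp)
  have hb := ((contMDiffAt_along_iff hx (hι x)).1 hB).mdifferentiableAt (by simp)
  have hf' := hf.mdifferentiableAt (by simp)
  have hfb : MDifferentiableAt 𝓘(ℝ, E) 𝓘(ℝ, F) (fun y ↦ f y • coord (ι x) (ι y) (B y)) x :=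
    hf'.smul hb
  let b : M → F := fun y ↦ coord (ι x) (ι y) (B y)
  have h1 : mvfderiv 𝓘(ℝ, E) (fun y ↦ f y • b y) x u =
      mvfderiv 𝓘(ℝ, E) f x u • b x + f x • mvfderiv 𝓘(ℝ, E) b x u :=
    mvfderiv_bilin (ContinuousLinearMap.lsmul ℝ ℝ) hf' hb u
  have h2 : mvfderiv 𝓘(ℝ, E) (fun y ↦ coord (ι x) (ι y) (V y)) x u =
      mvfderiv 𝓘(ℝ, E) (fun y ↦ coord (ι x) (ι y) (A y)) x u +
        mvfderiv 𝓘(ℝ, E) (fun y ↦ f y • b y) x u := by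
    rw [← add_apply, ← mvfderiv_add ha hfb]
    refine congrArg (fun T : E →L[ℝ] F ↦ T u) (mvfderiv_congr ?_)
    filter_upwards [heq] with y hy
    simp [hy]
  apply coord_injective hx
  simp only [map_add, map_smul, hcov hV, hcov hA, hcov hB]
  rw [h2, h1, heq.self_of_nhds]
  simp only [map_add, map_smul, b, add_apply, smul_apply, smul_add]
  abel

section Lightlike

variable [FiniteDimensional ℝ E]

omit [FiniteDimensional ℝ E] in
theorem contMDiffAt_ambientDeriv (hnabla : nabla.ContMDiffCovariantDerivative ∞)
    (hι : ContMDiff 𝓘(ℝ, E) 𝓘(ℝ, F) ∞ ι) {X Y : Π y : M, TangentSpace 𝓘(ℝ, E) y}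
    (hX : IsSmoothField X) (hY : IsSmoothField Y) (x : M) :
    ContMDiffAt 𝓘(ℝ, E) 𝓘(ℝ, F).tangent ∞
      (fun y ↦ (⟨ι y, ambientDeriv nabla ι X Y y⟩ : TangentBundle 𝓘(ℝ, F) N)) x := by
  obtain ⟨Γ, hΓ⟩ := exists_isConnectionForm nabla hnabla (ι x)
  exact hΓ.contMDiffAt_covAlong hι (hX x) (contMDiffAt_mfderiv_apply (hι x) (hY x))

theorem isSmoothField_inducedConnection (hnabla : nabla.ContMDiffCovariantDerivative ∞)
    (hι : IsLightlikeHypersurface (E := E) g ι) (S : ScreenDistribution (E := E) g ι)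
    {X Y : Π y : M, TangentSpace 𝓘(ℝ, E) y} (hX : IsSmoothField X) (hY : IsSmoothField Y) :
    IsSmoothField (inducedConnection nabla S X Y) := fun x ↦
  tangentialPart_contMDiffAt hι S
    (contMDiffAt_ambientDeriv hnabla hι.immersion.contMDiff hX hY x)

/-- The derivation `R · R` inserts the fields `R(V₁,V₂)X` into `R`, where the Gauss equation asks
for smooth arguments. -/
theorem isSmoothField_inducedCurvature (hnabla : nabla.ContMDiffCovariantDerivative ∞)
    (hι : IsLightlikeHypersurface (E := E) g ι) (S : ScreenDistribution (E := E) g ι)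
    {X Y Z : Π y : M, TangentSpace 𝓘(ℝ, E) y} (hX : IsSmoothField X) (hY : IsSmoothField Y)
    (hZ : IsSmoothField Z) : IsSmoothField (inducedCurvature nabla S X Y Z) := by
  have hD {X Y : Π y : M, TangentSpace 𝓘(ℝ, E) y} (hX : IsSmoothField X) (hY : IsSmoothField Y) :=
    isSmoothField_inducedConnection hnabla hι S hX hY
  exact ((hD hX (hD hY hZ)).sub_section (hD hY (hD hX hZ))).sub_section (hD (hX.mlieBracket hY) hZ)

omit [FiniteDimensional ℝ F] [T2Space N] in
/-- On a totally umbilical lightlike hypersurface the second fundamental form of every screen is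
a multiple of the metric. -/
theorem IsNullPair.ambientDeriv_eq (hι : IsLightlikeHypersurface (E := E) g ι)
    {S S₀ : ScreenDistribution (E := E) g ι} {x : M} {ξ : TangentSpace 𝓘(ℝ, E) x}
    {n : TangentSpace 𝓘(ℝ, F) (ι x)} (h : IsNullPair S x ξ n)
    {X Y : Π y : M, TangentSpace 𝓘(ℝ, E) y} {H₀ : TangentSpace 𝓘(ℝ, F) (ι x)}
    (h₀ : secondFundamentalForm nabla S₀ X Y x = inducedMetric g ι x (X x) (Y x) • H₀) :
    ambientDeriv nabla ι X Y x =
      mfderiv 𝓘(ℝ, E) 𝓘(ℝ, F) ι x (inducedConnection nabla S X Y x) +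
        inducedMetric g ι x (X x) (Y x) •
          (g.val (ι x) H₀ (mfderiv 𝓘(ℝ, E) 𝓘(ℝ, F) ι x ξ) • n) := by
  have h1 := sub_eq_iff_eq_add.1 h₀
  have h2 : g.val (ι x) (ambientDeriv nabla ι X Y x) (mfderiv 𝓘(ℝ, E) 𝓘(ℝ, F) ι x ξ) =
      inducedMetric g ι x (X x) (Y x) * g.val (ι x) H₀ (mfderiv 𝓘(ℝ, E) 𝓘(ℝ, F) ι x ξ) := by
    rw [h1, map_add, add_apply, h.metric_mfderiv, map_smul, smul_apply, add_zero, smul_eq_mul]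
  rw [smul_smul, ← h2]
  exact (h.mfderiv_tangentialPart hι _).symm

/-- The Gauss equation of a totally umbilical lightlike hypersurface of a space of constant
curvature. -/
theorem exists_inducedCurvature_eq (hnabla : IsLeviCivita g nabla) {c : ℝ}
    (hc : HasConstantSectionalCurvature g nabla c)
    (hι : IsLightlikeHypersurface (E := E) g ι) (humb : IsTotallyUmbilical (E := E) g nabla ι)
    (S : ScreenDistribution (E := E) g ι) (x : M) :
    ∃ L : TangentSpace 𝓘(ℝ, E) x → TangentSpace 𝓘(ℝ, E) x,
      ∀ X Y Z : Π y : M, TangentSpace 𝓘(ℝ, E) y,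
        IsSmoothField X → IsSmoothField Y → IsSmoothField Z →
        inducedCurvature nabla S X Y Z x = inducedMetric g ι x (Y x) (Z x) • L (X x) -
          inducedMetric g ι x (X x) (Z x) • L (Y x) := by
  obtain ⟨S₀, H₀, hH₀, -, hh⟩ := humb
  obtain ⟨ξ, n, hξ, hn, hξn⟩ := exists_isNullPair hι S x
  have hιs : ContMDiff 𝓘(ℝ, E) 𝓘(ℝ, F) ∞ ι := hι.immersion.contMDiff
  obtain ⟨Γ, hΓ⟩ := exists_isConnectionForm nabla hnabla.smooth (ι x)
  have h := hξn.self_of_nhds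
  let dι (y : M) : TangentSpace 𝓘(ℝ, E) y →L[ℝ] TangentSpace 𝓘(ℝ, F) (ι y) :=
    mfderiv 𝓘(ℝ, E) 𝓘(ℝ, F) ι y
  let θ (y : M) : ℝ := g.val (ι y) (H₀ y) (dι y (ξ y))
  -- The mean curvature section for the screen `S`, obtained from `H₀` by keeping its product with
  -- `ξ` and replacing the transversal direction by `n`.
  let H (y : M) : TangentSpace 𝓘(ℝ, F) (ι y) := θ y • n y
  have hH : ContMDiffAt 𝓘(ℝ, E) 𝓘(ℝ, F).tangent ∞
      (fun y ↦ (⟨ι y, H y⟩ : TangentBundle 𝓘(ℝ, F) N)) x :=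
    contMDiffAt_along_smul hιs hn
      (contMDiffAt_metric g hιs (hH₀ x) (contMDiffAt_mfderiv_apply (hιs x) hξ))
  have hamb {X Y : Π y : M, TangentSpace 𝓘(ℝ, E) y} (hX : IsSmoothField X) (hY : IsSmoothField Y) :
      ∀ᶠ y in 𝓝 x, ambientDeriv nabla ι X Y y = dι y (inducedConnection nabla S X Y y) +
        inducedMetric g ι y (X y) (Y y) • H y := by
    filter_upwards [hξn] with y hy
    exact hy.ambientDeriv_eq hι (hh X Y hX hY y)
  have hD {X Y : Π y : M, TangentSpace 𝓘(ℝ, E) y} (hX : IsSmoothField X) (hY : IsSmoothField Y) :=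
    isSmoothField_inducedConnection hnabla.smooth hι S hX hY
  have hdι {X : Π y : M, TangentSpace 𝓘(ℝ, E) y} (hX : IsSmoothField X) :=
    contMDiffAt_mfderiv_apply (hιs x) (hX x)
  have hmain {X Y Z : Π y : M, TangentSpace 𝓘(ℝ, E) y} (hX : IsSmoothField X)
      (hY : IsSmoothField Y) (hZ : IsSmoothField Z) :
      covAlong nabla ι (fun y ↦ covAlong nabla ι (fun y ↦ dι y (Z y)) y (Y y)) x (X x) =
        dι x (inducedConnection nabla S X (inducedConnection nabla S Y Z) x) +
          inducedMetric g ι x (X x) (inducedConnection nabla S Y Z x) • H x +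
          inducedMetric g ι x (Y x) (Z x) • covAlong nabla ι H x (X x) +
          mvfderiv 𝓘(ℝ, E) (fun y ↦ inducedMetric g ι y (Y y) (Z y)) x (X x) • H x := by
    rw [← (hamb hX (hD hY hZ)).self_of_nhds]
    exact covAlong_add_smul hnabla.smooth hιs
      (contMDiffAt_ambientDeriv hnabla.smooth hιs hY hZ x) (hdι (hD hY hZ)) hH
      (contMDiffAt_metric g hιs (hdι hY) (hdι hZ)) (hamb hY hZ) (X x)
  -- The term `c u` is the ambient curvature; the other is the tangential part of `∇bar_u H`, which
  -- appears when `B(Y,Z) H` is differentiated.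
  refine ⟨fun u ↦ c • u - tangentialPart S x (covAlong nabla ι H x u), fun X Y Z hX hY hZ ↦ ?_⟩
  have hflat := congrArg (coordSymm (ι x) (ι x))
    (hΓ.curvature_along hιs (hX x) (hY x) (hdι hZ))
  -- The null vectors `ξ` and `n` span a hyperbolic plane with Gram determinant `-1`.
  have hQ : g.val (ι x) (dι x (ξ x)) (dι x (ξ x)) * g.val (ι x) (n x) (n x) -
      g.val (ι x) (dι x (ξ x)) (n x) ^ 2 ≠ 0 := by
    rw [h.null, h.pairing]
    norm_num
  rw [coordSymm_coord (mem_chart_source F (ι x)), hc.coordSymm_curvatureForm hnabla hΓ hQ] at hflat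
  have hbr := (hamb (hX.mlieBracket hY) hZ).self_of_nhds
  have hτ (u : TangentSpace 𝓘(ℝ, E) x) := h.mfderiv_tangentialPart hι (covAlong nabla ι H x u)
  have hgauss := hflat
  change covAlong nabla ι (fun y ↦ covAlong nabla ι (fun y ↦ dι y (Z y)) y (Y y)) x (X x) -
    covAlong nabla ι (fun y ↦ covAlong nabla ι (fun y ↦ dι y (Z y)) y (X y)) x (Y x) -
    ambientDeriv nabla ι (VectorField.mlieBracket 𝓘(ℝ, E) X Y) Z x =
      c • (inducedMetric g ι x (Y x) (Z x) • dι x (X x) -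
        inducedMetric g ι x (X x) (Z x) • dι x (Y x)) at hgauss
  rw [hmain hX hY hZ, hmain hY hX hZ, hbr, ← hτ (X x), ← hτ (Y x)] at hgauss
  -- Only the tangential components are compared; `t` collects every coefficient of `n`, and its
  -- value is not needed.
  refine (h.eq_of_decomposition hι (t := θ x * (inducedMetric g ι x (X x)
        (inducedConnection nabla S Y Z x) - inducedMetric g ι x (Y x)
        (inducedConnection nabla S X Z x) +
      mvfderiv 𝓘(ℝ, E) (fun y ↦ inducedMetric g ι y (Y y) (Z y)) x (X x) -
      mvfderiv 𝓘(ℝ, E) (fun y ↦ inducedMetric g ι y (X y) (Z y)) x (Y x) -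
      inducedMetric g ι x (VectorField.mlieBracket 𝓘(ℝ, E) X Y x) (Z x)) +
    inducedMetric g ι x (Y x) (Z x) * g.val (ι x) (covAlong nabla ι H x (X x)) (dι x (ξ x)) -
    inducedMetric g ι x (X x) (Z x) * g.val (ι x) (covAlong nabla ι H x (Y x)) (dι x (ξ x)))
    (t' := 0) ?_).1
  change dι x (inducedConnection nabla S X (inducedConnection nabla S Y Z) x -
    inducedConnection nabla S Y (inducedConnection nabla S X Z) x -
    inducedConnection nabla S (VectorField.mlieBracket 𝓘(ℝ, E) X Y) Z x) + _ = dι x _ + _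
  simp only [map_sub, (dι x).map_smul]
  linear_combination (norm := module) hgauss

end Lightlike

end

/-! ### Pair symmetry of Gauss type tensors -/

section

section Algebra

variable {T : Type*} [AddCommGroup T] {B : T → T → ℝ} (hsymm : ∀ u v, B u v = B v u)
  (hadd : ∀ u u' v, B (u + u') v = B u v + B u' v) {L : T → T}

include hsymm hadd in
/-- A Gauss type tensor `B(Y,Z) B(LX,W) - B(X,Z) B(LY,W)` with the pair symmetry comes from an
operator `L` which is scalar modulo the radical of `B`. -/
theorem exists_scalar_of_pair_symm
    (hpair : ∀ X Y Z W, B Y Z * B (L X) W - B X Z * B (L Y) W =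
      B W X * B (L Z) Y - B Z X * B (L W) Y) :
    ∃ μ : ℝ, ∀ X W, B (L X) W = μ * B X W := by
  by_cases hB : ∀ u v, B u v = 0
  · exact ⟨0, fun X W ↦ by rw [hB, zero_mul]⟩
  obtain ⟨a, ha⟩ : ∃ a, B a a ≠ 0 := by
    by_contra! h
    refine hB fun u v ↦ ?_
    have h1 := h (u + v)
    rw [hadd, hsymm u, hsymm v, hadd, hadd, h, h, hsymm v u] at h1
    linarith
  -- Pair symmetry with `W = Z`, where the right side cancels.
  have hdiag (X Y Z : T) : B Y Z * B (L X) Z = B X Z * B (L Y) Z := by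
    linarith [hpair X Y Z Z, hpair Z Z X Y]
  obtain ⟨μ, hμ⟩ : ∃ μ, B (L a) a = μ * B a a := ⟨_, (div_mul_cancel₀ _ ha).symm⟩
  have hCa (X : T) : B (L X) a = μ * B X a :=
    mul_left_cancel₀ ha (by linear_combination hdiag X a a + B X a * hμ)
  refine ⟨μ, fun X W ↦ ?_⟩
  -- If `B(·,W)` is proportional to `B(·,a)`, the value on `W` follows from that on `a`. Otherwise
  -- `W` has its own factor `r`, to be compared with `μ`.
  by_cases hW : ∀ X, B a a * B X W = B X a * B a W
  · exact mul_left_cancel₀ ha (by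
      linear_combination hW (L X) + B a W * hCa X - μ * hW X)
  push Not at hW
  obtain ⟨X₀, hX₀⟩ := hW
  obtain ⟨Y, hY⟩ : ∃ Y, B Y W ≠ 0 := by
    by_contra! h
    exact hX₀ (by rw [h, h, mul_zero, mul_zero])
  obtain ⟨r, hr⟩ : ∃ r, B (L Y) W = r * B Y W := ⟨_, (div_mul_cancel₀ _ hY).symm⟩
  have hCW (X : T) : B (L X) W = r * B X W :=
    mul_left_cancel₀ hY (by linear_combination hdiag X Y W + B X W * hr)
  have hrμ : r = μ := by
    refine mul_right_cancel₀ (sub_ne_zero.2 hX₀) ?_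
    -- Both sides are the same determinant, nonzero by the choice of `X₀`, multiplied by `r` and by
    -- `μ`.
    have h := hpair X₀ a a W
    rw [hCW, hCW, hCa, hCa, hsymm W X₀, hsymm a X₀, hsymm W a] at h
    linear_combination h
  rw [hCW, hrμ]

omit [AddCommGroup T] in
include hsymm in
-- Modulo the radical `L` is the scalar `μ`, so the tensor is `μ (B(Y,Z) B(X,W) - B(X,Z) B(Y,W))`,
-- and a `B`-skew `A` acts on each factor `B` by zero.
theorem derivation_eq_zero {μ : ℝ} (hL : ∀ X W, B (L X) W = μ * B X W) (A : T → T)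
    (hA : ∀ X Y, B (A X) Y = - B (A Y) X) (X Y Z W : T) :
    - (B Y Z * B (L (A X)) W - B (A X) Z * B (L Y) W)
      - (B (A Y) Z * B (L X) W - B X Z * B (L (A Y)) W)
      - (B Y (A Z) * B (L X) W - B X (A Z) * B (L Y) W)
      - (B Y Z * B (L X) (A W) - B X Z * B (L Y) (A W)) = 0 := by
  simp only [hL]
  rw [hsymm Y (A Z), hsymm X (A Z), hsymm X (A W), hsymm Y (A W), hA Z Y, hA Z X, hA W X, hA W Y]
  ring

end Algebra

end

end

end LightlikeGeometry

/-! ### Reduction of the theorem to algebra at one point. -/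

theorem theorem5p2
    {E : Type*} [NormedAddCommGroup E] [NormedSpace ℝ E] [FiniteDimensional ℝ E]
    {F : Type*} [NormedAddCommGroup F] [NormedSpace ℝ F] [FiniteDimensional ℝ F]
    {M : Type*} [TopologicalSpace M] [T2Space M] [ChartedSpace E M] [IsManifold 𝓘(ℝ, E) ∞ M]
    {N : Type*} [TopologicalSpace N] [T2Space N] [ChartedSpace F N] [IsManifold 𝓘(ℝ, F) ∞ N]
    (g : LightlikeGeometry.SemiRiemannianMetric F N)
    (nabla : CovariantDerivative 𝓘(ℝ, F) F (TangentSpace 𝓘(ℝ, F) : N → Type _))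
    (hnabla : LightlikeGeometry.IsLeviCivita g nabla)
    (c : ℝ) (hc : LightlikeGeometry.HasConstantSectionalCurvature g nabla c)
    (ι : M → N) (hι : LightlikeGeometry.IsLightlikeHypersurface (E := E) g ι)
    (humb : LightlikeGeometry.IsTotallyUmbilical (E := E) g nabla ι)
    (S : LightlikeGeometry.ScreenDistribution (E := E) g ι)
    (hS : LightlikeGeometry.IsAdmissible nabla S) :
    LightlikeGeometry.IsSemiSymmetric nabla S := by
  intro V₁ V₂ X Y Z T hV₁ hV₂ hX hY hZ hT x
  obtain ⟨L, hL⟩ := LightlikeGeometry.exists_inducedCurvature_eq hnabla hc hι humb S x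
  have hform {X Y Z W : Π y : M, TangentSpace 𝓘(ℝ, E) y} (hX : LightlikeGeometry.IsSmoothField X)
      (hY : LightlikeGeometry.IsSmoothField Y) (hZ : LightlikeGeometry.IsSmoothField Z) :
      LightlikeGeometry.inducedCurvatureForm nabla S X Y Z W x =
        LightlikeGeometry.inducedMetric g ι x (Y x) (Z x) *
            LightlikeGeometry.inducedMetric g ι x (L (X x)) (W x) -
          LightlikeGeometry.inducedMetric g ι x (X x) (Z x) *
            LightlikeGeometry.inducedMetric g ι x (L (Y x)) (W x) := by
    rw [LightlikeGeometry.inducedCurvatureForm, hL X Y Z hX hY hZ,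
      LightlikeGeometry.inducedMetric_sub_left, LightlikeGeometry.inducedMetric_smul_left,
      LightlikeGeometry.inducedMetric_smul_left]
  -- Admissibility concerns fields; extending tangent vectors to smooth fields turns it into a
  -- pointwise identity for `L`.
  obtain ⟨μ, hμ⟩ := LightlikeGeometry.exists_scalar_of_pair_symm
    (LightlikeGeometry.inducedMetric_symm (g := g) (ι := ι) x)
    (LightlikeGeometry.inducedMetric_add_left x) (L := L) fun u v w z ↦ by
      obtain ⟨X, hX, rfl⟩ := LightlikeGeometry.exists_smoothField x u
      obtain ⟨Y, hY, rfl⟩ := LightlikeGeometry.exists_smoothField x v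
      obtain ⟨Z, hZ, rfl⟩ := LightlikeGeometry.exists_smoothField x w
      obtain ⟨W, hW, rfl⟩ := LightlikeGeometry.exists_smoothField x z
      rw [← hform hX hY hZ, ← hform hZ hW hX]
      exact (hS X Y Z W hX hY hZ hW x).2.1
  have hR {X : Π y : M, TangentSpace 𝓘(ℝ, E) y} (hX : LightlikeGeometry.IsSmoothField X) :=
    LightlikeGeometry.isSmoothField_inducedCurvature hnabla.smooth hι S hV₁ hV₂ hX
  -- The value of `R(V₁,V₂)` at `x` as an operator. It is skew because, modulo the radical, `L` can
  -- be replaced by `μ`.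
  let A (u : TangentSpace 𝓘(ℝ, E) x) : TangentSpace 𝓘(ℝ, E) x :=
    LightlikeGeometry.inducedMetric g ι x (V₂ x) u • L (V₁ x) -
      LightlikeGeometry.inducedMetric g ι x (V₁ x) u • L (V₂ x)
  have hA (u v : TangentSpace 𝓘(ℝ, E) x) : LightlikeGeometry.inducedMetric g ι x (A u) v =
      - LightlikeGeometry.inducedMetric g ι x (A v) u := by
    simp only [A, LightlikeGeometry.inducedMetric_sub_left,
      LightlikeGeometry.inducedMetric_smul_left, hμ]
    ring
  have h := LightlikeGeometry.derivation_eq_zero (LightlikeGeometry.inducedMetric_symm x) hμ A hA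
    (X x) (Y x) (Z x) (T x)
  rw [LightlikeGeometry.curvatureDerivation, hform (hR hX) hY hZ, hform hX (hR hY) hZ,
    hform hX hY (hR hZ), hform hX hY hZ, hL V₁ V₂ X hV₁ hV₂ hX, hL V₁ V₂ Y hV₁ hV₂ hY,
    hL V₁ V₂ Z hV₁ hV₂ hZ, hL V₁ V₂ T hV₁ hV₂ hT]
  exact h
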